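/- Let $R=\bigoplus_{n\ge 0}R_n$ be a standard graded commutative Noetherian ring (that is, $R$ is generated as an $R_0$-algebra by $R_1$) such that $R_0$ is a local ring with maximal ideal $\mathfrak m_0$, and let $R_+=\bigoplus_{n>0}R_n$. Let $M$ and $N$ be finitely generated $\mathbb Z$-graded $R$-modules. For a homogeneous ideal $\mathfrak b$ of $R$ and $i\ge 0$, let $$H^i_{\mathfrak b}(M,N)=\varinjlim_{t}\operatorname{Ext}^i_R(M/\mathfrak b^tM,N)$$ be the $i$-th generalized local cohomology module, with its natural grading, in which the homogeneous component $H^i_{\mathfrak b}(M,N)_n$ consists of the classes of elements of degree $n$ of the graded modules $\operatorname{Ext}^i_R(M/\mathfrak b^tM,N)$. Put $$a^*_{\mathfrak b}(M,N)=\sup_{i\ge 0}\,\sup\{n\in\mathbb Z : H^i_{\mathfrak b}(M,N)_n\neq 0\}\in\mathbb Z\cup\{\pm\infty\},$$ where $\sup\emptyset=-\infty$. Let $\mathfrak a_0=xR_0\subseteq\mathfrak m_0$ be a principal ideal of $R_0$, and let $\mathfrak a=\mathfrak a_0R+R_+$. Then $$a^*_{\mathfrak a}(M,N)=a^*_{R_+}(M,N).$$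 -/

import Mathlib

open CategoryTheory CategoryTheory.Limits CategoryTheory.Abelian

universe u

noncomputable section

/-- A `ℤ`-graded module over the `ℕ`-graded commutative ring `R = ⨁ 𝒜 n`: an `R`-module which is the
internal direct sum of additive subgroups `gr n`, with `𝒜 i • gr n ⊆ gr (i + n)`. -/
structure GrMod {R : Type u} [CommRing R] (𝒜 : ℕ → AddSubgroup R) where
  carrier : Type u
  [addCommGroup : AddCommGroup carrier]
  [module : Module R carrier]
  gr : ℤ → AddSubgroup carrier
  isInternal : DirectSum.IsInternal gr
  smul_mem : ∀ ⦃i : ℕ⦄ ⦃n : ℤ⦄ ⦃r : R⦄ ⦃m : carrier⦄,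
    r ∈ 𝒜 i → m ∈ gr n → r • m ∈ gr ((i : ℤ) + n)

namespace GrMod

attribute [instance] addCommGroup module

/-- A criterion for an internal direct sum in terms of projections. -/
theorem isInternal_of_proj {M : Type u} [AddCommGroup M] (gr : ℤ → AddSubgroup M)
    (p : ℤ → M →+ M) (h1 : ∀ n, ∀ x ∈ gr n, p n x = x)
    (h2 : ∀ n k, k ≠ n → ∀ x ∈ gr k, p n x = 0)
    (h3 : ∀ x : M, x ∈ ⨆ n, gr n) : DirectSum.IsInternal gr := by
  constructor
  · have key : ∀ (n : ℤ) (f : DirectSum ℤ (fun n => gr n)),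
        p n (DirectSum.coeAddMonoidHom gr f) = f n := by
      intro n f
      induction f using DirectSum.induction_on with
      | zero => simp
      | of k x =>
        rw [DirectSum.coeAddMonoidHom_of]
        by_cases hk : k = n
        · subst hk
          rw [DirectSum.of_eq_same]
          exact h1 _ _ x.2
        · rw [DirectSum.of_eq_of_ne _ _ _ (Ne.symm hk)]
          exact h2 _ _ hk _ x.2
      | add f g hf hg => simp [hf, hg]
    intro f g hfg
    refine DFinsupp.ext fun n => Subtype.ext ?_
    have := congrArg (p n) hfg
    rwa [key, key] at this
  · intro x
    refine AddSubgroup.iSup_induction gr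
      (C := fun x => ∃ f, DirectSum.coeAddMonoidHom gr f = x) (h3 x) ?_ ?_ ?_
    · intro n x hx
      exact ⟨DirectSum.of (fun n => gr n) n ⟨x, hx⟩, DirectSum.coeAddMonoidHom_of _ _ _⟩
    · exact ⟨0, map_zero _⟩
    · rintro x y ⟨f, rfl⟩ ⟨g, rfl⟩
      exact ⟨f + g, map_add _ _ _⟩

variable {R : Type u} [CommRing R] {𝒜 : ℕ → AddSubgroup R}

/-- The homogeneous component of degree `n` of an element of a graded module. -/
def proj (M : GrMod 𝒜) (n : ℤ) : M.carrier →+ M.carrier :=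
  ((M.gr n).subtype.comp (DFinsupp.evalAddMonoidHom n)).comp
    (AddEquiv.ofBijective (DirectSum.coeAddMonoidHom M.gr) M.isInternal).symm.toAddMonoidHom

theorem proj_mem (M : GrMod 𝒜) (n : ℤ) (x : M.carrier) : M.proj n x ∈ M.gr n :=
  SetLike.coe_mem _

theorem equiv_symm_of_mem (M : GrMod 𝒜) {k : ℤ} {x : M.carrier} (hx : x ∈ M.gr k) :
    (AddEquiv.ofBijective (DirectSum.coeAddMonoidHom M.gr) M.isInternal).symm x =
      DirectSum.of (fun n => M.gr n) k ⟨x, hx⟩ := by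
  rw [AddEquiv.symm_apply_eq]
  exact (DirectSum.coeAddMonoidHom_of M.gr k ⟨x, hx⟩).symm

theorem proj_of_mem (M : GrMod 𝒜) {n : ℤ} {x : M.carrier} (hx : x ∈ M.gr n) :
    M.proj n x = x := by
  change (((AddEquiv.ofBijective (DirectSum.coeAddMonoidHom M.gr) M.isInternal).symm x) n : M.carrier)
    = x
  rw [equiv_symm_of_mem M hx, DirectSum.of_eq_same]

theorem proj_of_mem_ne (M : GrMod 𝒜) {n k : ℤ} (h : k ≠ n) {x : M.carrier} (hx : x ∈ M.gr k) :
    M.proj n x = 0 := by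
  change (((AddEquiv.ofBijective (DirectSum.coeAddMonoidHom M.gr) M.isInternal).symm x) n : M.carrier)
    = 0
  rw [equiv_symm_of_mem M hx, DirectSum.of_eq_of_ne _ _ _ (Ne.symm h)]
  rfl

theorem sum_proj (M : GrMod 𝒜) (x : M.carrier) :
    ∃ s : Finset ℤ, ∑ n ∈ s, M.proj n x = x := by
  classical
  let e := AddEquiv.ofBijective (DirectSum.coeAddMonoidHom M.gr) M.isInternal
  refine ⟨(e.symm x).support, ?_⟩
  have h : DirectSum.coeAddMonoidHom M.gr (e.symm x) = x := e.apply_symm_apply x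
  rw [DirectSum.coeAddMonoidHom_eq_dfinsuppSum] at h
  exact h

theorem induction_gr (M : GrMod 𝒜) {P : M.carrier → Prop} (h0 : P 0)
    (hadd : ∀ x y, P x → P y → P (x + y)) (hgr : ∀ n, ∀ x ∈ M.gr n, P x) (x : M.carrier) : P x := by
  obtain ⟨s, hs⟩ := M.sum_proj x
  rw [← hs]
  exact Finset.sum_induction _ P hadd h0 fun n _ => hgr n _ (M.proj_mem n x)

/-- A morphism of graded modules is an `R`-linear map that preserves degrees. -/
@[ext]
structure Hom (M N : GrMod 𝒜) where
  lin : M.carrier →ₗ[R] N.carrier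
  map_mem : ∀ (n : ℤ), ∀ x ∈ M.gr n, lin x ∈ N.gr n

instance : Category (GrMod 𝒜) where
  Hom M N := Hom M N
  id M := ⟨LinearMap.id, fun _ _ hx => hx⟩
  comp f g := ⟨g.lin.comp f.lin, fun n x hx => g.map_mem n _ (f.map_mem n x hx)⟩

@[ext]
theorem hom_ext {M N : GrMod 𝒜} {f g : M ⟶ N} (h : f.lin = g.lin) : f = g := Hom.ext h

@[simp] theorem id_lin (M : GrMod 𝒜) : Hom.lin (𝟙 M) = LinearMap.id := rfl

@[simp] theorem comp_lin {M N P : GrMod 𝒜} (f : M ⟶ N) (g : N ⟶ P) :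
    Hom.lin (f ≫ g) = g.lin.comp f.lin := rfl

theorem map_proj {M N : GrMod 𝒜} (f : M ⟶ N) (n : ℤ) (x : M.carrier) :
    f.lin (M.proj n x) = N.proj n (f.lin x) := by
  induction x using M.induction_gr with
  | h0 => simp
  | hadd x y hx hy => simp [hx, hy]
  | hgr k x hx =>
    by_cases hk : k = n
    · subst hk
      rw [proj_of_mem _ hx, proj_of_mem _ (f.map_mem _ _ hx)]
    · rw [proj_of_mem_ne _ hk hx, proj_of_mem_ne _ hk (f.map_mem _ _ hx), map_zero]

instance (M N : GrMod 𝒜) : Zero (M ⟶ N) :=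
  ⟨⟨0, fun n _ _ => (N.gr n).zero_mem⟩⟩

instance (M N : GrMod 𝒜) : Add (M ⟶ N) :=
  ⟨fun f g => ⟨f.lin + g.lin, fun n x hx => (N.gr n).add_mem (f.map_mem n x hx) (g.map_mem n x hx)⟩⟩

instance (M N : GrMod 𝒜) : Neg (M ⟶ N) :=
  ⟨fun f => ⟨-f.lin, fun n x hx => (N.gr n).neg_mem (f.map_mem n x hx)⟩⟩

instance (M N : GrMod 𝒜) : Sub (M ⟶ N) :=
  ⟨fun f g => ⟨f.lin - g.lin, fun n x hx => (N.gr n).sub_mem (f.map_mem n x hx) (g.map_mem n x hx)⟩⟩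

instance (M N : GrMod 𝒜) : SMul ℕ (M ⟶ N) :=
  ⟨fun k f => ⟨k • f.lin, fun n x hx => (N.gr n).nsmul_mem (f.map_mem n x hx) k⟩⟩

instance (M N : GrMod 𝒜) : SMul ℤ (M ⟶ N) :=
  ⟨fun k f => ⟨k • f.lin, fun n x hx => (N.gr n).zsmul_mem (f.map_mem n x hx) k⟩⟩

instance (M N : GrMod 𝒜) : AddCommGroup (M ⟶ N) :=
  Function.Injective.addCommGroup (Hom.lin : (M ⟶ N) → (M.carrier →ₗ[R] N.carrier))
    (fun _ _ h => hom_ext h) rfl (fun _ _ => rfl) (fun _ => rfl) (fun _ _ => rfl)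
    (fun _ _ => rfl) (fun _ _ => rfl)

@[simp] theorem zero_lin (M N : GrMod 𝒜) : Hom.lin (0 : M ⟶ N) = 0 := rfl

@[simp] theorem add_lin {M N : GrMod 𝒜} (f g : M ⟶ N) : Hom.lin (f + g) = f.lin + g.lin := rfl

instance : Preadditive (GrMod 𝒜) where
  add_comp _ _ _ f f' g := by ext x; simp
  comp_add _ _ _ f g g' := by ext x; simp

/-- The underlying `R`-module of a graded module. -/
def forgetGr (𝒜 : ℕ → AddSubgroup R) : GrMod 𝒜 ⥤ ModuleCat.{u} R where
  obj M := ModuleCat.of R M.carrier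
  map f := ModuleCat.ofHom f.lin

instance : (forgetGr 𝒜).Additive where
  map_add := rfl

instance : (forgetGr 𝒜).Faithful where
  map_injective h := hom_ext (congrArg ModuleCat.Hom.hom h)

instance : (forgetGr 𝒜).ReflectsIsomorphisms where
  reflects {M N} f hf := by
    have hb : Function.Bijective f.lin := ConcreteCategory.bijective_of_isIso ((forgetGr 𝒜).map f)
    let e := LinearEquiv.ofBijective f.lin hb
    have he : ∀ x, f.lin (e.symm x) = x := e.apply_symm_apply
    refine ⟨⟨⟨e.symm.toLinearMap, fun n x hx => ?_⟩, ?_, ?_⟩⟩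
    · have : (e.symm x : M.carrier) = M.proj n (e.symm x) := by
        apply hb.1
        rw [map_proj, he, proj_of_mem _ hx]
      change e.symm x ∈ M.gr n
      rw [this]
      exact M.proj_mem _ _
    · ext x
      exact e.symm_apply_apply x
    · ext x
      exact he x

/-- A graded submodule: an `R`-submodule that contains the homogeneous components of its
elements. -/
def IsHomog (M : GrMod 𝒜) (K : Submodule R M.carrier) : Prop :=
  ∀ (n : ℤ), ∀ x ∈ K, M.proj n x ∈ K

/-- A homogeneous submodule as a graded module, `K_n = K ∩ M_n`. -/
def sub (M : GrMod 𝒜) (K : Submodule R M.carrier) (hK : M.IsHomog K) : GrMod 𝒜 where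
  carrier := K
  gr n := (M.gr n).comap K.subtype.toAddMonoidHom
  isInternal := by
    refine isInternal_of_proj _
      (fun n => ((M.proj n).comp K.subtype.toAddMonoidHom).codRestrict K (fun x => hK n x x.2))
      (fun n x hx => Subtype.ext (M.proj_of_mem hx))
      (fun n k hk x hx => Subtype.ext (M.proj_of_mem_ne hk hx)) (fun x => ?_)
    obtain ⟨s, hs⟩ := M.sum_proj x
    have : x = ∑ n ∈ s, (⟨M.proj n x, hK n x x.2⟩ : K) :=
      Subtype.ext (by rw [AddSubmonoidClass.coe_finsetSum]; exact hs.symm)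
    rw [this]
    exact sum_mem fun n _ => AddSubgroup.mem_iSup_of_mem n (M.proj_mem n x)
  smul_mem _ _ _ _ hr hm := M.smul_mem hr hm

/-- The quotient by a homogeneous submodule as a graded module, `(M / K)_n` being the image
of `M_n`. -/
def quot (M : GrMod 𝒜) (K : Submodule R M.carrier) (hK : M.IsHomog K) : GrMod 𝒜 where
  carrier := M.carrier ⧸ K
  gr n := (M.gr n).map K.mkQ.toAddMonoidHom
  isInternal := by
    refine isInternal_of_proj _
      (fun n => QuotientAddGroup.map K.toAddSubgroup K.toAddSubgroup (M.proj n)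
        (fun x hx => hK n x hx)) ?_ ?_ ?_
    · rintro n _ ⟨x, hx, rfl⟩
      exact congrArg K.mkQ (M.proj_of_mem hx)
    · rintro n k hk _ ⟨x, hx, rfl⟩
      exact (congrArg K.mkQ (M.proj_of_mem_ne hk hx)).trans (map_zero _)
    · intro y
      obtain ⟨x, rfl⟩ := K.mkQ_surjective y
      obtain ⟨s, hs⟩ := M.sum_proj x
      rw [← hs, map_sum]
      exact sum_mem fun n _ => AddSubgroup.mem_iSup_of_mem n ⟨_, M.proj_mem n x, rfl⟩
  smul_mem := by
    rintro i n r _ hr ⟨x, hx, rfl⟩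
    exact ⟨r • x, M.smul_mem hr hx, K.mkQ.map_smul r x⟩

/-- The direct sum of two graded modules. -/
def prod (M N : GrMod 𝒜) : GrMod 𝒜 where
  carrier := M.carrier × N.carrier
  gr n := (M.gr n).prod (N.gr n)
  isInternal := by
    refine isInternal_of_proj _ (fun n => (M.proj n).prodMap (N.proj n)) ?_ ?_ ?_
    · rintro n x ⟨h1, h2⟩
      exact Prod.ext (M.proj_of_mem h1) (N.proj_of_mem h2)
    · rintro n k hk x ⟨h1, h2⟩
      exact Prod.ext (M.proj_of_mem_ne hk h1) (N.proj_of_mem_ne hk h2)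
    · rintro ⟨x, y⟩
      obtain ⟨s, hs⟩ := M.sum_proj x
      obtain ⟨t, ht⟩ := N.sum_proj y
      have : (x, y) = ∑ n ∈ s, (AddMonoidHom.inl M.carrier N.carrier) (M.proj n x) +
          ∑ n ∈ t, (AddMonoidHom.inr M.carrier N.carrier) (N.proj n y) := by
        rw [← map_sum, ← map_sum, hs, ht]
        simp
      rw [this]
      exact add_mem
        (sum_mem fun n _ => AddSubgroup.mem_iSup_of_mem n ⟨M.proj_mem n x, (N.gr n).zero_mem⟩)
        (sum_mem fun n _ => AddSubgroup.mem_iSup_of_mem n ⟨(M.gr n).zero_mem, N.proj_mem n y⟩)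
  smul_mem _ _ _ _ hr hm := ⟨M.smul_mem hr hm.1, N.smul_mem hr hm.2⟩

/-- The zero graded module. -/
def zeroObj (𝒜 : ℕ → AddSubgroup R) : GrMod 𝒜 where
  carrier := PUnit
  gr _ := ⊥
  isInternal := by
    refine isInternal_of_proj _ (fun _ => 0) ?_ ?_ ?_
    · intro n x _
      rfl
    · intro n k _ x _
      rfl
    · intro x
      exact zero_mem (⨆ _ : ℤ, (⊥ : AddSubgroup PUnit))
  smul_mem _ _ _ _ _ _ := rfl

instance : HasZeroObject (GrMod 𝒜) :=
  ⟨zeroObj 𝒜, by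
    rw [IsZero.iff_id_eq_zero]
    ext x
    rfl⟩

instance : HasBinaryBiproducts (GrMod 𝒜) where
  has_binary_biproduct M N := HasBinaryBiproduct.mk
    { bicone :=
        { pt := prod M N
          fst := ⟨LinearMap.fst R M.carrier N.carrier, fun _ _ h => h.1⟩
          snd := ⟨LinearMap.snd R M.carrier N.carrier, fun _ _ h => h.2⟩
          inl := ⟨LinearMap.inl R M.carrier N.carrier, fun n _ h => ⟨h, (N.gr n).zero_mem⟩⟩
          inr := ⟨LinearMap.inr R M.carrier N.carrier, fun n _ h => ⟨(M.gr n).zero_mem, h⟩⟩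
          inl_fst := rfl
          inl_snd := rfl
          inr_fst := rfl
          inr_snd := rfl }
      isBilimit := isBinaryBilimitOfTotal _ (by
        refine hom_ext (LinearMap.ext ?_)
        rintro ⟨x, y⟩
        exact Prod.ext (add_zero x) (zero_add y)) }

instance : HasFiniteProducts (GrMod 𝒜) :=
  hasFiniteProducts_of_has_binary_and_terminal

theorem isHomog_ker {M N : GrMod 𝒜} (f : M ⟶ N) : M.IsHomog (LinearMap.ker f.lin) := by
  intro n x hx
  rw [LinearMap.mem_ker] at hx ⊢
  rw [map_proj, hx, map_zero]

theorem isHomog_range {M N : GrMod 𝒜} (f : M ⟶ N) : N.IsHomog (LinearMap.range f.lin) := by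
  rintro n _ ⟨x, rfl⟩
  exact ⟨M.proj n x, map_proj f n x⟩

/-- The inclusion of a homogeneous submodule. -/
def subι (M : GrMod 𝒜) (K : Submodule R M.carrier) (hK : M.IsHomog K) : M.sub K hK ⟶ M :=
  ⟨K.subtype, fun _ _ h => h⟩

/-- The projection to the quotient by a homogeneous submodule. -/
def quotπ (M : GrMod 𝒜) (K : Submodule R M.carrier) (hK : M.IsHomog K) : M ⟶ M.quot K hK :=
  ⟨K.mkQ, fun _ x h => ⟨x, h, rfl⟩⟩

/-- The kernel fork of a morphism of graded modules. -/
def kerFork {M N : GrMod 𝒜} (f : M ⟶ N) : KernelFork f :=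
  KernelFork.ofι (M.subι _ (isHomog_ker f)) (by
    refine hom_ext (LinearMap.ext fun x => ?_)
    exact x.2)

/-- The cokernel cofork of a morphism of graded modules. -/
def cokerCofork {M N : GrMod 𝒜} (f : M ⟶ N) : CokernelCofork f :=
  CokernelCofork.ofπ (N.quotπ _ (isHomog_range f)) (by
    refine hom_ext (LinearMap.ext fun x => ?_)
    exact (Submodule.Quotient.mk_eq_zero _).2 ⟨x, rfl⟩)

/-- `kerFork f` is a kernel. -/
def kerForkIsLimit {M N : GrMod 𝒜} (f : M ⟶ N) : IsLimit (kerFork f) :=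
  KernelFork.IsLimit.ofι _ (kerFork f).condition
    (fun {W} g hg => ⟨g.lin.codRestrict _ (fun x => by
        have := congrArg (fun h : W ⟶ N => h.lin x) hg
        exact this), fun n x hx => g.map_mem n x hx⟩)
    (fun _ _ => rfl)
    (fun {W} g hg m hm => by
      refine hom_ext (LinearMap.ext fun x => Subtype.ext ?_)
      exact congrArg (fun h : W ⟶ M => h.lin x) hm)

/-- `cokerCofork f` is a cokernel. -/
def cokerCoforkIsColimit {M N : GrMod 𝒜} (f : M ⟶ N) : IsColimit (cokerCofork f) :=
  CokernelCofork.IsColimit.ofπ _ (cokerCofork f).condition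
    (fun {W} g hg => ⟨(LinearMap.range f.lin).liftQ g.lin (by
        rintro _ ⟨x, rfl⟩
        have := congrArg (fun h : M ⟶ W => h.lin x) hg
        exact this), by
        rintro n _ ⟨x, hx, rfl⟩
        exact g.map_mem n x hx⟩)
    (fun _ _ => rfl)
    (fun {W} g hg m hm => by
      refine hom_ext (LinearMap.ext fun y => ?_)
      obtain ⟨x, rfl⟩ := Submodule.mkQ_surjective _ y
      exact congrArg (fun h : N ⟶ W => h.lin x) hm)

instance : HasKernels (GrMod 𝒜) where
  has_limit f := ⟨⟨_, kerForkIsLimit f⟩⟩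

instance : HasCokernels (GrMod 𝒜) where
  has_colimit f := ⟨⟨_, cokerCoforkIsColimit f⟩⟩

instance {M N : GrMod 𝒜} (f : M ⟶ N) : PreservesLimit (parallelPair f 0) (forgetGr 𝒜) :=
  preservesLimit_of_preserves_limit_cone (kerForkIsLimit f)
    ((KernelFork.isLimitMapConeEquiv _ (forgetGr 𝒜)).symm
      (ModuleCat.kernelIsLimit ((forgetGr 𝒜).map f)))

instance {M N : GrMod 𝒜} (f : M ⟶ N) : PreservesColimit (parallelPair f 0) (forgetGr 𝒜) :=
  preservesColimit_of_preserves_colimit_cocone (cokerCoforkIsColimit f)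
    ((CokernelCofork.isColimitMapCoconeEquiv _ (forgetGr 𝒜)).symm
      (ModuleCat.cokernelIsColimit ((forgetGr 𝒜).map f)))

instance {M N : GrMod 𝒜} (f : M ⟶ N) : IsIso (Abelian.coimageImageComparison f) :=
  have := IsIso.of_isIso_fac_right (Abelian.PreservesCoimage.hom_coimageImageComparison
      (forgetGr 𝒜) f).symm
  isIso_of_reflects_iso _ (forgetGr 𝒜)

instance : Abelian (GrMod 𝒜) := Abelian.ofCoimageImageComparisonIsIso

instance : PreservesFiniteLimits (forgetGr 𝒜) :=
  (forgetGr 𝒜).preservesFiniteLimits_of_preservesKernels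

instance : PreservesFiniteColimits (forgetGr 𝒜) :=
  (forgetGr 𝒜).preservesFiniteColimits_of_preservesCokernels

instance : HasExt.{u + 1} (GrMod 𝒜) := HasExt.standard _

/-- The shifted graded module `M(n)`, with `M(n)_k = M_{n + k}`. -/
def shift (M : GrMod 𝒜) (n : ℤ) : GrMod 𝒜 where
  carrier := M.carrier
  gr k := M.gr (n + k)
  isInternal := by
    refine isInternal_of_proj _ (fun k => M.proj (n + k)) (fun k x hx => M.proj_of_mem hx)
      (fun k l hl x hx => M.proj_of_mem_ne (by omega) hx) (fun x => ?_)
    obtain ⟨s, hs⟩ := M.sum_proj x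
    rw [← hs]
    refine sum_mem fun k _ => AddSubgroup.mem_iSup_of_mem (k - n) ?_
    rw [add_sub_cancel]
    exact M.proj_mem k x
  smul_mem i k r m hr hm := by
    have := M.smul_mem hr hm
    rwa [add_left_comm] at this

/-- The additive subgroup `Ext^i_R(M, N)_n` of homogeneous elements of degree `n` in the `R`-module
`Ext^i_R(M, N)`: the image of the `Ext`-group `Ext^i(M, N(n))` of the category of graded modules.
For `i = 0` these are the `R`-linear maps `M → N` that raise degrees by `n`. -/
def extDegree (M N : GrMod 𝒜) (i : ℕ) (n : ℤ) :
    AddSubgroup (Ext ((forgetGr 𝒜).obj M) ((forgetGr 𝒜).obj N) i) :=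
  ((forgetGr 𝒜).mapExtAddHom M (N.shift n) i).range

variable [GradedRing 𝒜]

theorem isHomog_smul_top (M : GrMod 𝒜) (I : HomogeneousIdeal 𝒜) :
    M.IsHomog (I.toIdeal • (⊤ : Submodule R M.carrier)) := by
  classical
  intro n x hx
  induction hx using Submodule.smul_induction_on' with
  | add x _ y _ hx hy =>
    rw [map_add]
    exact add_mem hx hy
  | smul r hr m _ =>
    rw [← DirectSum.sum_support_decompose 𝒜 r, Finset.sum_smul, map_sum]
    refine sum_mem fun i _ => ?_
    have hri : (DirectSum.decompose 𝒜 r i : R) ∈ I.toIdeal := I.isHomogeneous i hr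
    induction m using M.induction_gr with
    | h0 => simp
    | hadd x y hx hy =>
      rw [smul_add, map_add]
      exact add_mem (hx trivial) (hy trivial)
    | hgr k y hy =>
      have hmem := M.smul_mem (SetLike.coe_mem (DirectSum.decompose 𝒜 r i)) hy
      by_cases hk : (i : ℤ) + k = n
      · subst hk
        rw [proj_of_mem _ hmem]
        exact Submodule.smul_mem_smul hri trivial
      · rw [proj_of_mem_ne _ hk hmem]
        exact zero_mem _

/-- The powers of a homogeneous ideal. -/
def idealPow (I : HomogeneousIdeal 𝒜) (t : ℕ) : HomogeneousIdeal 𝒜 where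
  toSubmodule := I.toIdeal ^ t
  is_homogeneous' := by
    induction t with
    | zero => rw [pow_zero, Ideal.one_eq_top]; exact Ideal.IsHomogeneous.top 𝒜
    | succ t ih => rw [pow_succ]; exact Ideal.IsHomogeneous.mul ih I.isHomogeneous

/-- The graded module `M / I ^ t M`. -/
def quotPow (I : HomogeneousIdeal 𝒜) (M : GrMod 𝒜) (t : ℕ) : GrMod 𝒜 :=
  M.quot _ (M.isHomog_smul_top (idealPow I t))

/-- The canonical projection `M / I ^ t M → M / I ^ s M` for `s ≤ t`. -/
def quotPowMap (I : HomogeneousIdeal 𝒜) (M : GrMod 𝒜) {s t : ℕ} (h : s ≤ t) :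
    quotPow I M t ⟶ quotPow I M s where
  lin := Submodule.factor (Submodule.smul_mono_left (Ideal.pow_le_pow_right h))
  map_mem := by
    rintro n _ ⟨x, hx, rfl⟩
    exact ⟨x, hx, rfl⟩

/-- The transition map `Ext^i_R(M / I ^ s M, N) → Ext^i_R(M / I ^ t M, N)` for `s ≤ t`. -/
def extTransition (I : HomogeneousIdeal 𝒜) (M N : GrMod 𝒜) (i s t : ℕ) (h : s ≤ t) :
    Ext ((forgetGr 𝒜).obj (quotPow I M s)) ((forgetGr 𝒜).obj N) i →ₗ[R]
      Ext ((forgetGr 𝒜).obj (quotPow I M t)) ((forgetGr 𝒜).obj N) i :=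
  (Ext.mk₀ ((forgetGr 𝒜).map (quotPowMap I M h))).precompOfLinear R ((forgetGr 𝒜).obj N)
    (zero_add i)

/-- The generalized local cohomology module `H^i_I(M, N)`, the direct limit over `t` of the
`R`-modules `Ext^i_R(M / I ^ t M, N)`. -/
abbrev genLocalCohomology (I : HomogeneousIdeal 𝒜) (M N : GrMod 𝒜) (i : ℕ) : Type u :=
  Module.DirectLimit
    (fun t : ℕ => Ext ((forgetGr 𝒜).obj (quotPow I M t)) ((forgetGr 𝒜).obj N) i)
    (fun s t h => extTransition I M N i s t h)

/-- The homogeneous component `H^i_I(M, N)_n`: the classes of the elements of degree `n` in the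
modules `Ext^i_R(M / I ^ t M, N)`. -/
def genLocalCohomologyDegree (I : HomogeneousIdeal 𝒜) (M N : GrMod 𝒜) (i : ℕ) (n : ℤ) :
    AddSubgroup (genLocalCohomology I M N i) :=
  ⨆ t : ℕ, (extDegree (quotPow I M t) N i n).map
    (Module.DirectLimit.of R ℕ
      (fun t : ℕ => Ext ((forgetGr 𝒜).obj (quotPow I M t)) ((forgetGr 𝒜).obj N) i)
      (fun s t h => extTransition I M N i s t h) t).toAddMonoidHom

/-- The end of a module with homogeneous components `X n`: the supremum in `[-∞, ∞]` of the `n` with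
`X n ≠ 0`, which is `-∞` if there are none. -/
def gradedEnd {H : Type u} [AddCommGroup H] (X : ℤ → AddSubgroup H) : EReal :=
  sSup {e : EReal | ∃ n : ℤ, X n ≠ ⊥ ∧ e = ((n : ℝ) : EReal)}

/-- The invariant `a^*_I(M, N)`, the supremum over `i ≥ 0` of the ends of `H^i_I(M, N)`. -/
def aStar (I : HomogeneousIdeal 𝒜) (M N : GrMod 𝒜) : EReal :=
  ⨆ i : ℕ, gradedEnd (genLocalCohomologyDegree I M N i)

/-- The homogeneous ideal `𝔞₀ + R₊` of `R` for an ideal `𝔞₀` of `R₀`. -/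
def addIrrelevant (𝒜 : ℕ → AddSubgroup R) [GradedRing 𝒜] (𝔞₀ : Ideal (𝒜 0)) :
    HomogeneousIdeal 𝒜 where
  toSubmodule := 𝔞₀.map (algebraMap (𝒜 0) R) ⊔ (HomogeneousIdeal.irrelevant 𝒜).toIdeal
  is_homogeneous' := by
    refine Ideal.IsHomogeneous.sup (Ideal.homogeneous_span 𝒜 _ ?_)
      (HomogeneousIdeal.irrelevant 𝒜).isHomogeneous
    rintro _ ⟨x, _, rfl⟩
    exact ⟨0, x.2⟩

end GrMod

end

/-!
# The invariant `a^*` is unchanged when a principal ideal of `R₀` is added to `R₊`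

Write `A = R₀`, `I = R₊` and `J = x R₀ + R₊`. It is shown degree by degree that all `H^i_J(M, N)_n`
vanish if and only if all `H^i_I(M, N)_n` do (`forall_limExt_eq_zero_iff`), which gives the equality of
the suprema.

The work takes place in the abelian category of graded modules, which is `A`-linear. A graded
`Ext`-group embeds into the `Ext`-group of the underlying modules
(`mapExactFunctor_forgetGr_injective`), because the degree zero component retracts linear maps onto
graded ones. Hence `H^i_I(M, N)_n` vanishes exactly when the direct limit `limExt` of the graded groups
`Ext^i(M / I ^ t M, N(n))` does (`genLocalCohomologyDegree_eq_bot_iff`).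

Put `L_t = M / I ^ t M` and consider the exact sequences
`0 → x ^ t L_t → L_t → L_t / x ^ t L_t → 0`. The towers `L_t / x ^ t L_t` and `M / J ^ t M` are cofinal in
each other (`quotTowerAcyclic_iff`), so the direct limit over `t` of the long exact `Ext`-sequences
relates `H_J` and `H_I` to the direct limit `Q` of `Ext^i(x ^ t L_t, N(n))`. As `L_t` is Noetherian,
multiplication by `x` is an isomorphism from `x ^ s L_t` to `x ^ (s + 1) L_t` for large `s`, so `x` acts
bijectively on `Q`.

* If `H_I` vanishes, then `H_J` is `Q` up to a shift of the cohomological degree. Every element of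
  `H_J` is killed by a power of `x`, so both vanish (`quotTowerAcyclic_of_limExt`).
* If `H_J` vanishes, then `H_I` is `Q`, so `x` acts surjectively on `H^i_I(M, N)_n`
  (`QuotTowerAcyclic.smul_surjective`). This is a Noetherian `A`-module (`finiteComponents`), hence zero
  by Nakayama's lemma.

The finiteness of `H^i_{R₊}(M, N)_n` over `A` is proved together with its vanishing for large `n`, by
induction on `i` and dévissage in `N`. If `R₊ N = 0`, then `H^i_{R₊}(M, N)` embeds into `Ext^i(M, N)`,
which rests on the Artin-Rees lemma (`exists_pull_subPow_eq_zero`). If some homogeneous `r` of positive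
degree is regular on `N`, then the sequence `0 → N → N(d) → C → 0` and the induction hypothesis for `C`
show that multiplication by `r` is injective in large degrees. Local cohomology is `r`-torsion, so it
vanishes there, and descending induction on the degree gives finiteness.
-/

noncomputable section

namespace GrMod

section

variable {R : Type u} [CommRing R] {𝒜 : ℕ → AddSubgroup R}

/-! ### Graded modules: exact sequences and maps -/

theorem comp_lin_apply {M N P : GrMod 𝒜} (f : M ⟶ N) (g : N ⟶ P) (x : M.carrier) :
    Hom.lin (f ≫ g) x = g.lin (f.lin x) := rfl

theorem ext_apply {M N : GrMod 𝒜} {f g : M ⟶ N} (h : ∀ x, f.lin x = g.lin x) : f = g :=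
  hom_ext (LinearMap.ext h)

theorem surjective_of_epi {M N : GrMod 𝒜} (f : M ⟶ N) [Epi f] : Function.Surjective f.lin :=
  (ModuleCat.epi_iff_surjective ((forgetGr 𝒜).map f)).1 inferInstance

theorem injective_of_mono {M N : GrMod 𝒜} (f : M ⟶ N) [Mono f] : Function.Injective f.lin :=
  (ModuleCat.mono_iff_injective ((forgetGr 𝒜).map f)).1 inferInstance

theorem epi_of_surjective {M N : GrMod 𝒜} (f : M ⟶ N) (h : Function.Surjective f.lin) : Epi f :=
  (forgetGr 𝒜).epi_of_epi_map ((ModuleCat.epi_iff_surjective ((forgetGr 𝒜).map f)).2 h)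

theorem mono_of_injective {M N : GrMod 𝒜} (f : M ⟶ N) (h : Function.Injective f.lin) : Mono f :=
  (forgetGr 𝒜).mono_of_mono_map ((ModuleCat.mono_iff_injective ((forgetGr 𝒜).map f)).2 h)

theorem isIso_of_bijective {M N : GrMod 𝒜} (f : M ⟶ N) (h : Function.Bijective f.lin) : IsIso f :=
  have := mono_of_injective f h.1
  have := epi_of_surjective f h.2
  isIso_of_mono_of_epi f

theorem shortExact_of_exact {X Y Z : GrMod 𝒜} (f : X ⟶ Y) (g : Y ⟶ Z)
    (hf : Function.Injective f.lin) (hfg : Function.Exact f.lin g.lin)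
    (hg : Function.Surjective g.lin) :
    (ShortComplex.mk f g (ext_apply fun x => hfg.apply_apply_eq_zero x)).ShortExact where
  exact := by
    rw [← ShortComplex.exact_map_iff_of_faithful _ (forgetGr 𝒜)]
    exact (ShortComplex.ShortExact.moduleCat_exact_iff_function_exact _).2 hfg
  mono_f := mono_of_injective f hf
  epi_g := epi_of_surjective g hg

theorem subι_comp_quotπ (M : GrMod 𝒜) (K : Submodule R M.carrier) (hK : M.IsHomog K) :
    M.subι K hK ≫ M.quotπ K hK = 0 :=
  ext_apply fun x => (Submodule.Quotient.mk_eq_zero _).2 x.2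

theorem subι_quotπ_shortExact (M : GrMod 𝒜) (K : Submodule R M.carrier) (hK : M.IsHomog K) :
    (ShortComplex.mk _ _ (M.subι_comp_quotπ K hK)).ShortExact :=
  shortExact_of_exact (M.subι K hK) (M.quotπ K hK) Subtype.val_injective
    (fun x => by
      change K.mkQ x = 0 ↔ x ∈ Set.range K.subtype
      simp)
    K.mkQ_surjective

theorem subι_ker_comp {M N : GrMod 𝒜} (g : M ⟶ N) : M.subι _ (isHomog_ker g) ≫ g = 0 :=
  ext_apply fun x => x.2

theorem subι_ker_shortExact {M N : GrMod 𝒜} (g : M ⟶ N) (hg : Function.Surjective g.lin) :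
    (ShortComplex.mk _ _ (subι_ker_comp g)).ShortExact :=
  shortExact_of_exact (M.subι _ (isHomog_ker g)) g Subtype.val_injective
    (fun x => by
      change g.lin x = 0 ↔ x ∈ Set.range (LinearMap.ker g.lin).subtype
      simp)
    hg

/-- The factorization through a homogeneous submodule of a morphism with values in it. -/
def subLift {M N : GrMod 𝒜} (K : Submodule R N.carrier) (hK : N.IsHomog K) (f : M ⟶ N)
    (h : ∀ x, f.lin x ∈ K) : M ⟶ N.sub K hK :=
  ⟨f.lin.codRestrict K h, f.map_mem⟩

theorem subLift_subι {M N : GrMod 𝒜} (K : Submodule R N.carrier) (hK : N.IsHomog K) (f : M ⟶ N)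
    (h : ∀ x, f.lin x ∈ K) : subLift K hK f h ≫ N.subι K hK = f := rfl

/-- The morphism out of a quotient induced by a morphism that vanishes on the submodule. -/
def quotDesc {M N : GrMod 𝒜} (K : Submodule R M.carrier) (hK : M.IsHomog K) (f : M ⟶ N)
    (h : K ≤ LinearMap.ker f.lin) : M.quot K hK ⟶ N :=
  ⟨K.liftQ f.lin h, by
    rintro n _ ⟨x, hx, rfl⟩
    exact f.map_mem n x hx⟩

theorem quotπ_quotDesc {M N : GrMod 𝒜} (K : Submodule R M.carrier) (hK : M.IsHomog K) (f : M ⟶ N)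
    (h : K ≤ LinearMap.ker f.lin) : M.quotπ K hK ≫ quotDesc K hK f h = f := rfl

theorem quot_hom_ext {M N : GrMod 𝒜} (K : Submodule R M.carrier) (hK : M.IsHomog K)
    {f g : M.quot K hK ⟶ N} (h : M.quotπ K hK ≫ f = M.quotπ K hK ≫ g) : f = g := by
  refine ext_apply fun y => ?_
  obtain ⟨x, rfl⟩ := K.mkQ_surjective y
  exact congrArg (fun k : M ⟶ N => k.lin x) h

section
variable [IsNoetherianRing R]

instance (M : GrMod 𝒜) (K : Submodule R M.carrier) (hK : M.IsHomog K) [Module.Finite R M.carrier] :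
    Module.Finite R (M.sub K hK).carrier :=
  inferInstanceAs (Module.Finite R K)

end

instance (M : GrMod 𝒜) (K : Submodule R M.carrier) (hK : M.IsHomog K) [Module.Finite R M.carrier] :
    Module.Finite R (M.quot K hK).carrier :=
  inferInstanceAs (Module.Finite R (M.carrier ⧸ K))

instance (M : GrMod 𝒜) (n : ℤ) [h : Module.Finite R M.carrier] :
    Module.Finite R (M.shift n).carrier := h

theorem smul_zero_mem (M : GrMod 𝒜) (a : 𝒜 0) {n : ℤ} {m : M.carrier} (hm : m ∈ M.gr n) :
    (a : R) • m ∈ M.gr n := by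
  simpa using M.smul_mem a.2 hm

/-- Graded modules form a category that is linear over the degree zero part of the ring. -/
instance [GradedRing 𝒜] : Linear (𝒜 0) (GrMod 𝒜) where
  homModule _ _ :=
    { smul a f := ⟨(a : R) • f.lin, fun n x hx => smul_zero_mem _ a (f.map_mem n x hx)⟩
      one_smul f := ext_apply fun x => one_smul R (f.lin x)
      mul_smul a b f := ext_apply fun x => mul_smul (a : R) (b : R) (f.lin x)
      smul_zero a := ext_apply fun _ => smul_zero (a : R)
      smul_add a f g := ext_apply fun x => smul_add (a : R) (f.lin x) (g.lin x)
      add_smul a b f := ext_apply fun x => add_smul (a : R) (b : R) (f.lin x)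
      zero_smul f := ext_apply fun x => zero_smul R (f.lin x) }
  smul_comp _ _ _ a f g := ext_apply fun x => g.lin.map_smul (a : R) (f.lin x)
  comp_smul _ _ _ _ _ _ := rfl

theorem ext_apply_mem {M N : GrMod 𝒜} {f g : M ⟶ N}
    (h : ∀ k, ∀ x ∈ M.gr k, f.lin x = g.lin x) : f = g := by
  refine ext_apply fun x => ?_
  induction x using M.induction_gr with
  | h0 => simp
  | hadd x y hx hy => simp [hx, hy]
  | hgr k x hx => exact h k x hx

theorem exists_homogeneous_generators (M : GrMod 𝒜) [Module.Finite R M.carrier] :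
    ∃ s : Finset M.carrier, (∀ m ∈ s, ∃ k, m ∈ M.gr k) ∧
      Submodule.span R (s : Set M.carrier) = ⊤ := by
  classical
  obtain ⟨t, ht⟩ := Module.Finite.fg_top (R := R) (M := M.carrier)
  choose S hS using fun x => M.sum_proj x
  refine ⟨t.biUnion fun x => (S x).image fun n => M.proj n x, ?_, ?_⟩
  · intro m hm
    simp only [Finset.mem_biUnion, Finset.mem_image] at hm
    obtain ⟨x, _, n, _, rfl⟩ := hm
    exact ⟨n, M.proj_mem n x⟩
  · rw [eq_top_iff, ← ht, Submodule.span_le]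
    intro x hx
    rw [SetLike.mem_coe, ← hS x]
    refine sum_mem fun n hn => Submodule.subset_span ?_
    simp only [Finset.coe_biUnion, Set.mem_iUnion, Finset.coe_image]
    exact ⟨x, hx, n, hn, rfl⟩

theorem hom_ext_of_span {M N : GrMod 𝒜} {s : Set M.carrier} (hs : Submodule.span R s = ⊤)
    {f g : M ⟶ N} (h : ∀ x ∈ s, f.lin x = g.lin x) : f = g :=
  hom_ext (LinearMap.ext_on hs h)

/-! ### Degree components of linear maps -/

/-- The degree zero component of an arbitrary `R`-linear map between graded modules: on elements
of degree `k` it is the component of degree `k` of the given map. -/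
def degZero [GradedRing 𝒜] {M N : GrMod 𝒜} (f : M.carrier →ₗ[R] N.carrier) : M ⟶ N := by
  let e := AddEquiv.ofBijective (DirectSum.coeAddMonoidHom M.gr) M.isInternal
  let g : M.carrier →+ N.carrier :=
    (DirectSum.toAddMonoid fun k => ((N.proj k).comp f.toAddMonoidHom).comp (M.gr k).subtype).comp
      e.symm.toAddMonoidHom
  have hg : ∀ k, ∀ x ∈ M.gr k, g x = N.proj k (f x) := by
    intro k x hx
    change DirectSum.toAddMonoid _ (e.symm x) = _
    rw [equiv_symm_of_mem M hx, DirectSum.toAddMonoid_of]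
    rfl
  have hsm : ∀ (r : R) (x : M.carrier), g (r • x) = r • g x := by
    intro r x
    induction r using DirectSum.Decomposition.inductionOn 𝒜 with
    | zero => simp
    | add a b ha hb => simp [add_smul, ha, hb]
    | @homogeneous i r =>
      induction x using M.induction_gr with
      | h0 => simp
      | hadd x y hx hy => simp [smul_add, hx, hy]
      | hgr k x hx =>
        rw [hg _ _ (M.smul_mem r.2 hx), hg _ _ hx, map_smul]
        induction f x using N.induction_gr with
        | h0 => simp
        | hadd y z hy hz => simp [smul_add, hy, hz]
        | hgr l y hy =>
          by_cases h : l = k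
          · subst h
            rw [proj_of_mem _ hy, proj_of_mem _ (N.smul_mem r.2 hy)]
          · rw [proj_of_mem_ne _ h hy, proj_of_mem_ne _ (by omega) (N.smul_mem r.2 hy), smul_zero]
  exact ⟨{ toFun := g, map_add' := g.map_add, map_smul' := hsm }, fun k x hx => by
    change g x ∈ _
    rw [hg k x hx]
    exact N.proj_mem k _⟩

section
variable [GradedRing 𝒜]

theorem degZero_apply_of_mem {M N : GrMod 𝒜} (f : M.carrier →ₗ[R] N.carrier) {k : ℤ}
    {x : M.carrier} (hx : x ∈ M.gr k) : (degZero f).lin x = N.proj k (f x) := by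
  change DirectSum.toAddMonoid (fun k => ((N.proj k).comp f.toAddMonoidHom).comp (M.gr k).subtype)
    ((AddEquiv.ofBijective (DirectSum.coeAddMonoidHom M.gr) M.isInternal).symm x) = _
  rw [equiv_symm_of_mem M hx, DirectSum.toAddMonoid_of]
  rfl

theorem degZero_lin {M N : GrMod 𝒜} (f : M ⟶ N) : degZero f.lin = f :=
  ext_apply_mem fun k x hx => by
    rw [degZero_apply_of_mem _ hx, proj_of_mem _ (f.map_mem k x hx)]

theorem comp_degZero {M N P : GrMod 𝒜} (f : M ⟶ N) (g : N.carrier →ₗ[R] P.carrier) :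
    f ≫ degZero g = degZero (g.comp f.lin) :=
  ext_apply_mem fun k x hx => by
    rw [degZero_apply_of_mem _ hx, comp_lin_apply, degZero_apply_of_mem _ (f.map_mem k x hx)]
    rfl

theorem degZero_comp {M N P : GrMod 𝒜} (f : M.carrier →ₗ[R] N.carrier) (g : N ⟶ P) :
    degZero f ≫ g = degZero (g.lin.comp f) :=
  ext_apply_mem fun k x hx => by
    rw [degZero_apply_of_mem _ hx, comp_lin_apply, degZero_apply_of_mem _ hx, map_proj]
    rfl

/-- A graded module is projective as soon as its underlying module is: take the degree zero
component of a lift. -/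
theorem projective_of_carrier (P : GrMod 𝒜) [Module.Projective R P.carrier] : Projective P where
  factors {E X} f e _ := by
    obtain ⟨h, hh⟩ := Module.projective_lifting_property e.lin f.lin (surjective_of_epi e)
    exact ⟨degZero h, by rw [degZero_comp, hh, degZero_lin]⟩

/-! ### Covers by graded modules that are free of finite rank -/

/-- The graded ring as a graded module over itself. -/
def self (𝒜 : ℕ → AddSubgroup R) [GradedRing 𝒜] : GrMod 𝒜 where
  carrier := R
  gr n := if 0 ≤ n then 𝒜 n.toNat else ⊥
  isInternal := by
    classical
    refine isInternal_of_proj _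
      (fun n => if 0 ≤ n then GradedRing.proj 𝒜 n.toNat else 0) ?_ ?_ ?_
    · intro n x hx
      split_ifs at hx ⊢ with h
      · rw [GradedRing.proj_apply, DirectSum.decompose_of_mem_same 𝒜 hx]
      · exact (AddSubgroup.mem_bot.1 hx).symm
    · intro n k hk x hx
      split_ifs at hx ⊢ with h h'
      · rw [GradedRing.proj_apply, DirectSum.decompose_of_mem_ne 𝒜 hx (by omega)]
      · rw [AddSubgroup.mem_bot.1 hx, map_zero]
      · rfl
      · rfl
    · intro x
      rw [← DirectSum.sum_support_decompose 𝒜 x]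
      refine sum_mem fun i _ => AddSubgroup.mem_iSup_of_mem (i : ℤ) ?_
      simp
  smul_mem := by
    intro i n r m hr hm
    by_cases h : 0 ≤ n
    · rw [if_pos h] at hm
      rw [if_pos (by omega), show ((i : ℤ) + n).toNat = i + n.toNat by omega]
      exact SetLike.GradedMul.mul_mem hr hm
    · rw [if_neg h] at hm
      rw [AddSubgroup.mem_bot.1 hm, smul_zero]
      exact zero_mem _

/-- The morphism `R(-k) → M` given by an element of `M` of degree `k`. -/
def ofElement (M : GrMod 𝒜) (k : ℤ) (m : M.carrier) (hm : m ∈ M.gr k) :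
    (self 𝒜).shift (-k) ⟶ M where
  lin := LinearMap.toSpanSingleton R M.carrier m
  map_mem n (r : R) hr := by
    change r • m ∈ _
    change r ∈ (if 0 ≤ -k + n then 𝒜 (-k + n).toNat else ⊥) at hr
    split_ifs at hr with h
    · have := M.smul_mem hr hm
      rwa [show (((-k + n).toNat : ℕ) : ℤ) + k = n by omega] at this
    · rw [AddSubgroup.mem_bot.1 hr, zero_smul]
      exact zero_mem _

/-- Every finitely generated graded module is a quotient of a finitely generated graded module whose
underlying module is projective. -/
theorem exists_projective_cover (M : GrMod 𝒜) [Module.Finite R M.carrier] :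
    ∃ (P : GrMod 𝒜) (g : P ⟶ M), Module.Finite R P.carrier ∧ Module.Projective R P.carrier ∧
      Function.Surjective g.lin := by
  classical
  obtain ⟨s, hs, hspan⟩ := M.exists_homogeneous_generators
  suffices h : ∀ t ⊆ s, ∃ (P : GrMod 𝒜) (g : P ⟶ M), Module.Finite R P.carrier ∧
      Module.Projective R P.carrier ∧ (t : Set M.carrier) ⊆ LinearMap.range g.lin by
    obtain ⟨P, g, h1, h2, h3⟩ := h s subset_rfl
    refine ⟨P, g, h1, h2, ?_⟩
    rw [← LinearMap.range_eq_top, eq_top_iff, ← hspan]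
    exact Submodule.span_le.2 h3
  intro t
  induction t using Finset.induction_on with
  | empty =>
    intro _
    refine ⟨zeroObj 𝒜, 0, inferInstanceAs (Module.Finite R PUnit.{u + 1}),
      inferInstanceAs (Module.Projective R PUnit.{u + 1}), by simp⟩
  | insert m t _ ih =>
    intro hts
    obtain ⟨P, g, h1, h2, h3⟩ := ih fun x hx => hts (Finset.mem_insert_of_mem hx)
    obtain ⟨k, hk⟩ := hs m (hts (Finset.mem_insert_self m t))
    let f := M.ofElement k m hk
    refine ⟨((self 𝒜).shift (-k)).prod P, (⟨f.lin.coprod g.lin, ?_⟩ : Hom _ _),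
      inferInstanceAs (Module.Finite R (R × P.carrier)),
      inferInstanceAs (Module.Projective R (R × P.carrier)), ?_⟩
    · rintro n ⟨x, y⟩ ⟨hx, hy⟩
      exact add_mem (f.map_mem n x hx) (g.map_mem n y hy)
    · intro x hx
      rw [Finset.coe_insert] at hx
      rcases hx with rfl | hx
      · refine ⟨((1 : R), (0 : P.carrier)), ?_⟩
        change (1 : R) • x + g.lin 0 = x
        rw [one_smul, map_zero, add_zero]
      · obtain ⟨y, rfl⟩ := h3 hx
        refine ⟨((0 : R), y), ?_⟩
        change f.lin (0 : R) + g.lin y = g.lin y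
        rw [show f.lin (0 : R) = 0 from zero_smul R m, zero_add]

end

end

section

variable {R : Type u} [CommRing R] {𝒜 : ℕ → AddSubgroup R} [GradedRing 𝒜]

/-! ### `Ext`-groups of graded modules -/

/-- The map `Ext^i(Y, N) → Ext^i(X, N)` induced by `f : X ⟶ Y` in the category of graded modules. -/
def pull {X Y : GrMod 𝒜} (f : X ⟶ Y) {N : GrMod 𝒜} {i : ℕ} : Ext Y N i →ₗ[𝒜 0] Ext X N i :=
  (Ext.mk₀ f).precompOfLinear (𝒜 0) N (zero_add i)

/-- The map `Ext^i(X, N) → Ext^i(X, N')` induced by `g : N ⟶ N'` in the category of graded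
modules. -/
def push {N N' : GrMod 𝒜} (g : N ⟶ N') {X : GrMod 𝒜} {i : ℕ} : Ext X N i →ₗ[𝒜 0] Ext X N' i :=
  (Ext.mk₀ g).postcompOfLinear (𝒜 0) X (add_zero i)

/-- The connecting map `Ext^i(S.X₁, N) → Ext^(i+1)(S.X₃, N)` of a short exact sequence of graded
modules in the first variable. -/
def connecting {S : ShortComplex (GrMod 𝒜)} (hS : S.ShortExact) {N : GrMod 𝒜} {i : ℕ} :
    Ext S.X₁ N i →ₗ[𝒜 0] Ext S.X₃ N (i + 1) :=
  hS.extClass.precompOfLinear (𝒜 0) N (add_comm 1 i)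

/-- The connecting map `Ext^i(X, S.X₃) → Ext^(i+1)(X, S.X₁)` of a short exact sequence of graded
modules in the second variable. -/
def coconnecting {S : ShortComplex (GrMod 𝒜)} (hS : S.ShortExact) {X : GrMod 𝒜} {i : ℕ} :
    Ext X S.X₃ i →ₗ[𝒜 0] Ext X S.X₁ (i + 1) :=
  hS.extClass.postcompOfLinear (𝒜 0) X rfl

section
variable {X Y Z N N' : GrMod 𝒜} {i : ℕ}

theorem pull_def (f : X ⟶ Y) (α : Ext Y N i) : pull f α = (Ext.mk₀ f).comp α (zero_add i) := rfl

theorem push_def (g : N ⟶ N') (α : Ext X N i) : push g α = α.comp (Ext.mk₀ g) (add_zero i) := rfl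

@[simp] theorem pull_id (α : Ext X N i) : pull (𝟙 X) α = α := Ext.mk₀_id_comp α

theorem pull_pull (f : X ⟶ Y) (g : Y ⟶ Z) (α : Ext Z N i) : pull f (pull g α) = pull (f ≫ g) α :=
  Ext.mk₀_comp_mk₀_assoc f g α

theorem pull_zero (α : Ext Y N i) : pull (0 : X ⟶ Y) α = 0 := by
  rw [pull_def, Ext.mk₀_zero, Ext.zero_comp]

theorem pull_smul_id (a : 𝒜 0) (α : Ext X N i) : pull (a • 𝟙 X) α = a • α := by
  rw [pull_def, Ext.mk₀_smul, Ext.smul_comp, Ext.mk₀_id_comp]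

theorem push_pull (f : X ⟶ Y) (g : N ⟶ N') (α : Ext Y N i) : push g (pull f α) = pull f (push g α) :=
  Ext.comp_assoc_of_third_deg_zero _ _ _ (zero_add i)

theorem pull_injective_of_epi (f : X ⟶ Y) [Epi f] :
    Function.Injective (pull f : Ext Y N 0 →ₗ[𝒜 0] Ext X N 0) :=
  Ext.precomp_mk₀_injective_of_epi N f

theorem push_injective_of_mono (g : N ⟶ N') [Mono g] :
    Function.Injective (push g : Ext X N 0 →ₗ[𝒜 0] Ext X N' 0) :=
  Ext.postcomp_mk₀_injective_of_mono X g

theorem pull_coconnecting {S : ShortComplex (GrMod 𝒜)} (hS : S.ShortExact) (f : X ⟶ Y)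
    (α : Ext Y S.X₃ i) : pull f (coconnecting hS α) = coconnecting hS (pull f α) :=
  (Ext.comp_assoc (Ext.mk₀ f) α hS.extClass (zero_add i) rfl (by omega)).symm

variable {S : ShortComplex (GrMod 𝒜)} (hS : S.ShortExact)

include hS in
theorem exists_pull_g_eq (α : Ext S.X₂ N i) (h : pull S.f α = 0) : ∃ β, pull S.g β = α :=
  Ext.contravariant_sequence_exact₂ hS N α h

theorem exists_connecting_eq (α : Ext S.X₃ N (i + 1)) (h : pull S.g α = 0) :
    ∃ β, connecting hS β = α :=
  Ext.contravariant_sequence_exact₃ hS N α h (add_comm 1 i)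

theorem exists_pull_f_eq (α : Ext S.X₁ N i) (h : connecting hS α = 0) : ∃ β, pull S.f β = α :=
  Ext.contravariant_sequence_exact₁ hS N α (add_comm 1 i) h

theorem connecting_pull_f (α : Ext S.X₂ N i) : connecting hS (pull S.f α) = 0 :=
  hS.extClass_comp_assoc α (h := add_comm 1 i)

include hS in
theorem exists_push_f_eq (α : Ext X S.X₂ i) (h : push S.g α = 0) : ∃ β, push S.f β = α :=
  Ext.covariant_sequence_exact₂ X hS α h

theorem exists_coconnecting_eq (α : Ext X S.X₁ (i + 1)) (h : push S.f α = 0) :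
    ∃ β, coconnecting hS β = α :=
  Ext.covariant_sequence_exact₁ X hS α h rfl

theorem connecting_pull {S' : ShortComplex (GrMod 𝒜)} (hS' : S'.ShortExact) (φ : S ⟶ S')
    (α : Ext S'.X₁ N i) : connecting hS (pull φ.τ₁ α) = pull φ.τ₃ (connecting hS' α) := by
  have h := ShortComplex.ShortExact.extClass_naturality hS hS' φ
  change hS.extClass.comp ((Ext.mk₀ φ.τ₁).comp α (zero_add i)) (add_comm 1 i) =
    (Ext.mk₀ φ.τ₃).comp (hS'.extClass.comp α (add_comm 1 i)) (zero_add (i + 1))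
  rw [← Ext.comp_assoc hS.extClass (Ext.mk₀ φ.τ₁) α (add_zero 1) (zero_add i) (by omega),
    ← Ext.comp_assoc (Ext.mk₀ φ.τ₃) hS'.extClass α (zero_add 1) (add_comm 1 i) (by omega), h]

end

/-! ### Comparison with the `Ext`-groups of the underlying modules -/

/-- The map from graded `Ext` to `Ext` of the underlying modules is injective. In degree `0` the
forgetful functor is faithful; in degree `1` a graded map on a syzygy that extends linearly also
extends as a graded map, by taking degree zero components; the general case follows by dimension
shifting. -/
theorem mapExactFunctor_forgetGr_injective [IsNoetherianRing R] {N : GrMod 𝒜} (i : ℕ) :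
    ∀ {M : GrMod 𝒜} [Module.Finite R M.carrier] (α : Ext M N i),
      α.mapExactFunctor (forgetGr 𝒜) = 0 → α = 0 := by
  induction i with
  | zero =>
    intro M _ α h
    obtain ⟨f, rfl⟩ := (Ext.mk₀_bijective _ _).2 α
    rw [Ext.mapExactFunctor_mk₀, Ext.mk₀_eq_zero_iff] at h
    rw [(forgetGr 𝒜).map_injective (h.trans ((forgetGr 𝒜).map_zero _ _).symm), Ext.mk₀_zero]
  | succ i ih =>
    intro M _ α h
    obtain ⟨P, g, _, _, hg⟩ := M.exists_projective_cover
    have := P.projective_of_carrier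
    have hS := subι_ker_shortExact g hg
    obtain ⟨β, rfl⟩ := exists_connecting_eq hS α (Ext.eq_zero_of_projective _)
    change (hS.extClass.comp β (add_comm 1 i)).mapExactFunctor (forgetGr 𝒜) = 0 at h
    rw [Ext.mapExactFunctor_comp, Ext.mapExactFunctor_extClass] at h
    obtain ⟨γ, hγ⟩ := Ext.contravariant_sequence_exact₁ (hS.map_of_exact (forgetGr 𝒜))
      ((forgetGr 𝒜).obj N) (β.mapExactFunctor (forgetGr 𝒜)) _ h
    cases i with
    | zero =>
      obtain ⟨f, rfl⟩ := (Ext.mk₀_bijective _ _).2 β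
      obtain ⟨k, rfl⟩ := (Ext.mk₀_bijective _ _).2 γ
      rw [Ext.mapExactFunctor_mk₀, Ext.mk₀_comp_mk₀] at hγ
      have hk := (Ext.mk₀_bijective _ _).1 hγ
      let l : P.carrier →ₗ[R] N.carrier := k.hom
      have hl : l.comp (Hom.lin (P.subι _ (isHomog_ker g))) = Hom.lin f :=
        congrArg ModuleCat.Hom.hom hk
      have hf : P.subι _ (isHomog_ker g) ≫ degZero l = f := by
        rw [comp_degZero, hl, degZero_lin]
      rw [← hf, ← Ext.mk₀_comp_mk₀]
      exact connecting_pull_f hS (Ext.mk₀ (degZero l))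
    | succ i =>
      have : Projective ((forgetGr 𝒜).obj P) :=
        (IsProjective.iff_projective (R := R) P.carrier).1 inferInstance
      have h0 : γ = 0 := @Ext.eq_zero_of_projective _ _ _ _ ((forgetGr 𝒜).obj P) _ _ this γ
      rw [h0, Ext.comp_zero] at hγ
      rw [ih β hγ.symm, map_zero]

end

section

variable {R : Type u} [CommRing R] {𝒜 : ℕ → AddSubgroup R} [GradedRing 𝒜]

/-! ### Finiteness of graded `Ext` over the degree zero part -/

instance (M : GrMod 𝒜) (n : ℤ) : SMul (𝒜 0) (M.gr n) :=
  ⟨fun a m => ⟨(a : R) • (m : M.carrier), M.smul_zero_mem a m.2⟩⟩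

instance (M : GrMod 𝒜) (n : ℤ) : Module (𝒜 0) (M.gr n) where
  one_smul m := Subtype.ext (one_smul R (m : M.carrier))
  mul_smul a b m := Subtype.ext (mul_smul (a : R) (b : R) (m : M.carrier))
  smul_zero a := Subtype.ext (smul_zero (a : R))
  smul_add a m m' := Subtype.ext (smul_add (a : R) (m : M.carrier) m')
  add_smul a b m := Subtype.ext (add_smul (a : R) (b : R) (m : M.carrier))
  zero_smul m := Subtype.ext (zero_smul R (m : M.carrier))

/-- The components of a finitely generated graded module over a Noetherian graded ring are
Noetherian, since `W` is recovered from `R • W` as its component of degree `n`. -/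
instance isNoetherian_gr [IsNoetherianRing R] (M : GrMod 𝒜) [Module.Finite R M.carrier] (n : ℤ) :
    IsNoetherian (𝒜 0) (M.gr n) := by
  let F : Submodule (𝒜 0) (M.gr n) → Submodule R M.carrier := fun W =>
    Submodule.span R (Subtype.val '' (W : Set (M.gr n)))
  have key : ∀ (W : Submodule (𝒜 0) (M.gr n)), ∀ y ∈ F W, ∀ r : R,
      ∃ w ∈ W, (w : M.carrier) = M.proj n (r • y) := by
    intro W y hy
    induction hy using Submodule.span_induction with
    | mem y hy =>
      obtain ⟨w, hw, rfl⟩ := hy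
      intro r
      induction r using DirectSum.Decomposition.inductionOn 𝒜 with
      | zero => exact ⟨0, W.zero_mem, by simp⟩
      | add a b ha hb =>
        obtain ⟨w₁, h₁, e₁⟩ := ha
        obtain ⟨w₂, h₂, e₂⟩ := hb
        exact ⟨w₁ + w₂, W.add_mem h₁ h₂, by rw [add_smul, map_add, ← e₁, ← e₂]; rfl⟩
      | @homogeneous i r =>
        have hm := M.smul_mem r.2 w.2
        rcases Nat.eq_zero_or_pos i with rfl | hi
        · exact ⟨r • w, W.smul_mem r hw, (M.proj_of_mem (M.smul_zero_mem r w.2)).symm⟩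
        · exact ⟨0, W.zero_mem, (M.proj_of_mem_ne (by omega) hm).symm⟩
    | zero => exact fun r => ⟨0, W.zero_mem, by simp⟩
    | add y z _ _ hy hz =>
      intro r
      obtain ⟨w₁, h₁, e₁⟩ := hy r
      obtain ⟨w₂, h₂, e₂⟩ := hz r
      exact ⟨w₁ + w₂, W.add_mem h₁ h₂, by rw [smul_add, map_add, ← e₁, ← e₂]; rfl⟩
    | smul a y _ hy =>
      intro r
      rw [smul_smul]
      exact hy (r * a)
  have hle : ∀ W W', F W ≤ F W' → W ≤ W' := by
    intro W W' h w hw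
    obtain ⟨w', hw', e⟩ := key W' w (h (Submodule.subset_span ⟨w, hw, rfl⟩)) 1
    rw [one_smul, M.proj_of_mem w.2] at e
    rwa [← Subtype.ext e]
  have hmono : StrictMono F := by
    intro W W' h
    refine lt_of_le_not_ge (Submodule.span_mono (Set.image_mono h.le)) fun h' => ?_
    exact not_le_of_gt h (hle _ _ h')
  rw [isNoetherian_iff']
  exact hmono.wellFoundedGT

/-- Evaluation of graded homomorphisms at finitely many homogeneous elements. -/
def evalHom (M N : GrMod 𝒜) {ι : Type*} (m : ι → M.carrier) (d : ι → ℤ)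
    (hm : ∀ j, m j ∈ M.gr (d j)) : (M ⟶ N) →ₗ[𝒜 0] (∀ j, N.gr (d j)) where
  toFun f j := ⟨f.lin (m j), f.map_mem _ _ (hm j)⟩
  map_add' _ _ := rfl
  map_smul' _ _ := rfl

theorem isNoetherian_hom [IsNoetherianRing R] (M N : GrMod 𝒜) [Module.Finite R M.carrier]
    [Module.Finite R N.carrier] : IsNoetherian (𝒜 0) (M ⟶ N) := by
  obtain ⟨s, hs, hspan⟩ := M.exists_homogeneous_generators
  choose d hd using fun m : s => hs m m.2
  refine isNoetherian_of_injective (evalHom M N (fun m : s => (m : M.carrier)) d hd) ?_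
  intro f g h
  refine hom_ext_of_span hspan fun x hx => ?_
  exact congrArg Subtype.val (congrFun h ⟨x, hx⟩)

/-- Dimension shifting: `Ext^(i+1)(M, -)` is a quotient of `Ext^i(K, -)` for a finitely generated
syzygy `K` of `M`. -/
theorem exists_syzygy [IsNoetherianRing R] (M : GrMod 𝒜) [Module.Finite R M.carrier] :
    ∃ K : GrMod 𝒜, Module.Finite R K.carrier ∧ ∀ (N : GrMod 𝒜) (i : ℕ),
      ∃ f : Ext K N i →ₗ[𝒜 0] Ext M N (i + 1), Function.Surjective f := by
  obtain ⟨P, g, _, _, hg⟩ := M.exists_projective_cover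
  have := P.projective_of_carrier
  exact ⟨P.sub _ (isHomog_ker g), inferInstance, fun N i =>
    ⟨connecting (subι_ker_shortExact g hg), fun α =>
      exists_connecting_eq (subι_ker_shortExact g hg) α (Ext.eq_zero_of_projective _)⟩⟩

theorem isNoetherian_ext [IsNoetherianRing R] (N : GrMod 𝒜) [Module.Finite R N.carrier] (i : ℕ) :
    ∀ (M : GrMod 𝒜) [Module.Finite R M.carrier], IsNoetherian (𝒜 0) (Ext M N i) := by
  induction i with
  | zero =>
    intro M _
    have := isNoetherian_hom M N
    exact isNoetherian_of_linearEquiv (Ext.linearEquiv₀ (R := 𝒜 0) (X := M) (Y := N)).symm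
  | succ i ih =>
    intro M _
    obtain ⟨K, _, h⟩ := M.exists_syzygy
    obtain ⟨f, hf⟩ := h N i
    have := ih K
    exact isNoetherian_of_surjective f (LinearMap.range_eq_top.2 hf)

/-- If the components of `N` vanish in large degrees, then so do those of `Ext^i(M, N)`. -/
theorem ext_shift_eventually_zero [IsNoetherianRing R] (N : GrMod 𝒜) {k : ℤ}
    (hN : ∀ n, k ≤ n → N.gr n = ⊥) (i : ℕ) :
    ∀ (M : GrMod 𝒜) [Module.Finite R M.carrier],
      ∃ n₀ : ℤ, ∀ n, n₀ ≤ n → ∀ α : Ext M (N.shift n) i, α = 0 := by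
  induction i with
  | zero =>
    intro M _
    obtain ⟨s, hs, hspan⟩ := M.exists_homogeneous_generators
    choose d hd using fun m : s => hs m m.2
    obtain ⟨b, hb⟩ := (Set.finite_range d).bddBelow
    -- A graded map `M → N(n)` sends a generator of degree `d ≥ b` into `N` in degree `n + d ≥ k`.
    refine ⟨k - b, fun n hn α => ?_⟩
    obtain ⟨f, rfl⟩ := (Ext.mk₀_bijective _ _).2 α
    rw [Ext.mk₀_eq_zero_iff]
    refine hom_ext_of_span hspan fun x hx => ?_
    have h : f.lin x ∈ N.gr (n + d ⟨x, hx⟩) := f.map_mem _ _ (hd ⟨x, hx⟩)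
    have h' : b ≤ d ⟨x, hx⟩ := hb ⟨_, rfl⟩
    rw [hN _ (by omega)] at h
    exact AddSubgroup.mem_bot.1 h
  | succ i ih =>
    intro M _
    obtain ⟨K, _, h⟩ := M.exists_syzygy
    obtain ⟨n₀, hn₀⟩ := ih K
    refine ⟨n₀, fun n hn α => ?_⟩
    obtain ⟨f, hf⟩ := h (N.shift n) i
    obtain ⟨β, rfl⟩ := hf α
    rw [hn₀ n hn β, map_zero]

end

section

variable {R : Type u} [CommRing R] {𝒜 : ℕ → AddSubgroup R} [GradedRing 𝒜]

/-! ### Generalized local cohomology as a colimit of graded `Ext`-groups -/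

theorem quotPowMap_mk (I : HomogeneousIdeal 𝒜) (M : GrMod 𝒜) {s t : ℕ} (h : s ≤ t)
    (x : M.carrier) :
    (quotPowMap I M h).lin (Submodule.Quotient.mk x) = Submodule.Quotient.mk x := rfl

theorem quotPowMap_comp (I : HomogeneousIdeal 𝒜) (M : GrMod 𝒜) {s t r : ℕ} (h : s ≤ t)
    (h' : t ≤ r) : quotPowMap I M h' ≫ quotPowMap I M h = quotPowMap I M (h.trans h') := by
  refine ext_apply fun y => ?_
  obtain ⟨x, rfl⟩ := Submodule.mkQ_surjective _ y
  exact (congrArg _ (quotPowMap_mk I M h' x)).trans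
    ((quotPowMap_mk I M h x).trans (quotPowMap_mk I M (h.trans h') x).symm)

theorem quotPowMap_rfl (I : HomogeneousIdeal 𝒜) (M : GrMod 𝒜) (t : ℕ) :
    quotPowMap I M (le_refl t) = 𝟙 _ :=
  quot_hom_ext _ _ rfl

/-- The projection `M → M / I ^ t M`. -/
def quotPowπ (I : HomogeneousIdeal 𝒜) (M : GrMod 𝒜) (t : ℕ) : M ⟶ quotPow I M t :=
  M.quotπ _ _

theorem quotPowπ_comp (I : HomogeneousIdeal 𝒜) (M : GrMod 𝒜) {s t : ℕ} (h : s ≤ t) :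
    quotPowπ I M t ≫ quotPowMap I M h = quotPowπ I M s := rfl

/-- The transition maps of the graded `Ext`-groups `Ext^i(M / I ^ t M, N)`. -/
def transition (I : HomogeneousIdeal 𝒜) (M N : GrMod 𝒜) (i : ℕ) (s t : ℕ) (h : s ≤ t) :
    Ext (quotPow I M s) N i →ₗ[𝒜 0] Ext (quotPow I M t) N i :=
  pull (quotPowMap I M h)

instance (I : HomogeneousIdeal 𝒜) (M N : GrMod 𝒜) (i : ℕ) :
    DirectedSystem (fun t => Ext (quotPow I M t) N i)
      (fun s t h => transition I M N i s t h) where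
  map_self t α := by
    change pull _ α = α
    rw [quotPowMap_rfl, pull_id]
  map_map r s t h h' α := by
    change pull _ (pull _ α) = pull _ α
    rw [pull_pull, quotPowMap_comp]

/-- The degree zero part `H^i_I(M, N)_0` of generalized local cohomology, as the direct limit over
`t` of the `Ext`-groups `Ext^i(M / I ^ t M, N)` of the category of graded modules. -/
def limExt (I : HomogeneousIdeal 𝒜) (M N : GrMod 𝒜) (i : ℕ) : Type (u + 1) :=
  Module.DirectLimit (fun t => Ext (quotPow I M t) N i) (fun s t h => transition I M N i s t h)

instance (I : HomogeneousIdeal 𝒜) (M N : GrMod 𝒜) (i : ℕ) : AddCommGroup (limExt I M N i) :=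
  inferInstanceAs (AddCommGroup (Module.DirectLimit _ _))

instance (I : HomogeneousIdeal 𝒜) (M N : GrMod 𝒜) (i : ℕ) : Module (𝒜 0) (limExt I M N i) :=
  inferInstanceAs (Module (𝒜 0) (Module.DirectLimit _ (fun s t h => transition I M N i s t h)))

/-- The class in the direct limit of an element of `Ext^i(M / I ^ t M, N)`. -/
def limExt.of (I : HomogeneousIdeal 𝒜) (M N : GrMod 𝒜) (i t : ℕ) :
    Ext (quotPow I M t) N i →ₗ[𝒜 0] limExt I M N i :=
  Module.DirectLimit.of (𝒜 0) ℕ (fun t => Ext (quotPow I M t) N i)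
    (fun s t h => transition I M N i s t h) t

section
variable {I : HomogeneousIdeal 𝒜} {M N N' : GrMod 𝒜} {i : ℕ}

theorem limExt.exists_of (z : limExt I M N i) : ∃ t α, limExt.of I M N i t α = z :=
  Module.DirectLimit.exists_of z

theorem limExt.of_pull {s t : ℕ} (h : s ≤ t) (α : Ext (quotPow I M s) N i) :
    limExt.of I M N i t (pull (quotPowMap I M h) α) = limExt.of I M N i s α :=
  Module.DirectLimit.of_f (hij := h)

theorem limExt.of_eq_zero_iff {t : ℕ} (α : Ext (quotPow I M t) N i) :
    limExt.of I M N i t α = 0 ↔ ∃ s, ∃ h : t ≤ s, pull (quotPowMap I M h) α = 0 := by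
  constructor
  · intro h
    obtain ⟨s, hs, e⟩ := Module.DirectLimit.of.zero_exact h
    exact ⟨s, hs, e⟩
  · rintro ⟨s, h, e⟩
    rw [← limExt.of_pull h, e, map_zero]

/-- The map of direct limits induced by `g : N ⟶ N'`. -/
def limExt.map (I : HomogeneousIdeal 𝒜) (M : GrMod 𝒜) (i : ℕ) (g : N ⟶ N') :
    limExt I M N i →ₗ[𝒜 0] limExt I M N' i :=
  Module.DirectLimit.map (fun _ => push g) fun _ _ _ => LinearMap.ext fun α => push_pull _ g α

theorem limExt.map_of (g : N ⟶ N') {t : ℕ} (α : Ext (quotPow I M t) N i) :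
    limExt.map I M i g (limExt.of I M N i t α) = limExt.of I M N' i t (push g α) :=
  Module.DirectLimit.map_apply_of _ _ _

/-- The connecting map of direct limits given by a short exact sequence in the second variable. -/
def limExt.δ (I : HomogeneousIdeal 𝒜) (M : GrMod 𝒜) (i : ℕ) {X Y Z : GrMod 𝒜} {f : X ⟶ Y}
    {g : Y ⟶ Z} {w : f ≫ g = 0} (hS : (ShortComplex.mk f g w).ShortExact) :
    limExt I M Z i →ₗ[𝒜 0] limExt I M X (i + 1) :=
  Module.DirectLimit.map (fun _ => coconnecting hS) fun _ _ _ =>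
    LinearMap.ext fun α => (pull_coconnecting hS _ α).symm

section
variable {X Y Z : GrMod 𝒜} {f : X ⟶ Y} {g : Y ⟶ Z} {w : f ≫ g = 0}
  (hS : (ShortComplex.mk f g w).ShortExact)

theorem limExt.δ_of {t : ℕ} (α : Ext (quotPow I M t) Z i) :
    limExt.δ I M i hS (limExt.of I M Z i t α) = limExt.of I M X (i + 1) t (coconnecting hS α) :=
  Module.DirectLimit.map_apply_of _ _ _

include hS in
theorem limExt.exists_map_f_eq (z : limExt I M Y i) (hz : limExt.map I M i g z = 0) :
    ∃ y, limExt.map I M i f y = z := by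
  obtain ⟨t, α, rfl⟩ := z.exists_of
  rw [limExt.map_of, limExt.of_eq_zero_iff] at hz
  obtain ⟨s, h, e⟩ := hz
  rw [← push_pull] at e
  obtain ⟨β, hβ⟩ := exists_push_f_eq hS _ e
  exact ⟨limExt.of I M _ i s β, by rw [limExt.map_of, hβ, limExt.of_pull]⟩

theorem limExt.exists_δ_eq (z : limExt I M X (i + 1)) (hz : limExt.map I M (i + 1) f z = 0) :
    ∃ y, limExt.δ I M i hS y = z := by
  obtain ⟨t, α, rfl⟩ := z.exists_of
  rw [limExt.map_of, limExt.of_eq_zero_iff] at hz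
  obtain ⟨s, h, e⟩ := hz
  rw [← push_pull] at e
  obtain ⟨β, hβ⟩ := exists_coconnecting_eq hS _ e
  exact ⟨limExt.of I M _ i s β, by rw [limExt.δ_of, hβ, limExt.of_pull]⟩

end

theorem limExt.map_injective_of_mono (g : N ⟶ N') [Mono g] :
    Function.Injective (limExt.map I M 0 g) := by
  rw [← LinearMap.ker_eq_bot, LinearMap.ker_eq_bot']
  intro z hz
  obtain ⟨t, α, rfl⟩ := z.exists_of
  rw [limExt.map_of, limExt.of_eq_zero_iff] at hz
  obtain ⟨s, h, e⟩ := hz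
  rw [← push_pull] at e
  rw [← limExt.of_pull h, push_injective_of_mono g (e.trans (map_zero _).symm), map_zero]

end

/-- The component of degree `n` of `H^i_I(M, N)` vanishes if and only if the direct limit of the
graded `Ext`-groups `Ext^i(M / I ^ t M, N(n))` does. -/
theorem genLocalCohomologyDegree_eq_bot_iff [IsNoetherianRing R] (I : HomogeneousIdeal 𝒜)
    (M N : GrMod 𝒜) [Module.Finite R M.carrier] (i : ℕ) (n : ℤ) :
    genLocalCohomologyDegree I M N i n = ⊥ ↔ ∀ z : limExt I M (N.shift n) i, z = 0 := by
  have key : ∀ {s t : ℕ} (h : s ≤ t) (α : Ext (quotPow I M s) (N.shift n) i),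
      extTransition I M N i s t h ((forgetGr 𝒜).mapExtAddHom _ (N.shift n) i α) =
        (forgetGr 𝒜).mapExtAddHom _ (N.shift n) i (pull (quotPowMap I M h) α) := by
    intro s t h α
    rw [Functor.mapExtAddHom_apply, Functor.mapExtAddHom_apply, pull_def,
      Ext.mapExactFunctor_comp, Ext.mapExactFunctor_mk₀]
    rfl
  have hfin : ∀ t, Module.Finite R (quotPow I M t).carrier := fun t =>
    inferInstanceAs (Module.Finite R (M.quot _ _).carrier)
  have hds : DirectedSystem
      (fun t : ℕ => Ext ((forgetGr 𝒜).obj (quotPow I M t)) ((forgetGr 𝒜).obj N) i)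
      (fun s t h => extTransition I M N i s t h) := by
    constructor
    · intro t α
      change (Ext.mk₀ ((forgetGr 𝒜).map (quotPowMap I M (le_refl t)))).comp α (zero_add i) = α
      rw [quotPowMap_rfl, (forgetGr 𝒜).map_id, Ext.mk₀_id_comp]
    · intro r s t h h' α
      change (Ext.mk₀ ((forgetGr 𝒜).map (quotPowMap I M h'))).comp
        ((Ext.mk₀ ((forgetGr 𝒜).map (quotPowMap I M h))).comp α (zero_add i)) (zero_add i) =
        (Ext.mk₀ ((forgetGr 𝒜).map (quotPowMap I M (h.trans h')))).comp α (zero_add i)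
      rw [Ext.mk₀_comp_mk₀_assoc, ← (forgetGr 𝒜).map_comp, quotPowMap_comp]
  rw [genLocalCohomologyDegree, iSup_eq_bot]
  constructor
  · intro h z
    obtain ⟨t, α, rfl⟩ := z.exists_of
    have h1 := h t
    rw [eq_bot_iff] at h1
    have h2 := AddSubgroup.mem_bot.1 (h1 ⟨_, ⟨α, rfl⟩, rfl⟩)
    obtain ⟨s, hs, e⟩ := Module.DirectLimit.of.zero_exact h2
    rw [limExt.of_eq_zero_iff]
    refine ⟨s, hs, mapExactFunctor_forgetGr_injective i _ ?_⟩
    exact (key hs α).symm.trans e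
  · intro h t
    rw [eq_bot_iff]
    rintro _ ⟨_, ⟨α, rfl⟩, rfl⟩
    obtain ⟨s, hs, e⟩ := (limExt.of_eq_zero_iff α).1 (h _)
    have e' := key hs α
    rw [e, map_zero] at e'
    exact AddSubgroup.mem_bot.2 ((Module.DirectLimit.of_f (hij := hs)).symm.trans
      ((congrArg _ e').trans (map_zero _)))

/-! ### The case of torsion coefficients -/

/-- The homogeneous submodule `I ^ s M` of `M`. -/
def subPow (I : HomogeneousIdeal 𝒜) (M : GrMod 𝒜) (s : ℕ) : GrMod 𝒜 :=
  M.sub _ (M.isHomog_smul_top (idealPow I s))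

/-- The inclusion `I ^ s M → M`. -/
def subPowι (I : HomogeneousIdeal 𝒜) (M : GrMod 𝒜) (s : ℕ) : subPow I M s ⟶ M :=
  M.subι _ _

theorem pull_eq_zero_of_range_le {I : HomogeneousIdeal 𝒜} {X L N : GrMod 𝒜} {i : ℕ} (f : X ⟶ L)
    {s : ℕ} (hf : ∀ x, f.lin x ∈ I.toIdeal ^ s • (⊤ : Submodule R L.carrier)) {α : Ext L N i}
    (hα : pull (subPowι I L s) α = 0) : pull f α = 0 := by
  let g : X ⟶ subPow I L s := subLift _ (L.isHomog_smul_top (idealPow I s)) f hf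
  change pull (g ≫ subPowι I L s) α = 0
  rw [← pull_pull, hα, map_zero]

theorem mem_smul_top_of_coe_mem (I : Ideal R) {M : Type*} [AddCommGroup M] [Module R M]
    {K : Submodule R M} {x : K} (hx : (x : M) ∈ I • K) : x ∈ I • (⊤ : Submodule R K) := by
  have h : (I • (⊤ : Submodule R K)).map K.subtype = I • K := by
    rw [Submodule.map_smul'', Submodule.map_subtype_top]
  rw [← h] at hx
  obtain ⟨y, hy, e⟩ := hx
  rwa [← Subtype.ext e]

/-- If `I N = 0`, then every class in `Ext^i(L, N)` restricts to zero on `I ^ s L` for large `s`.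
In degree zero this is clear; for the induction step write the class as a connecting image from
a syzygy of `L` and apply the Artin-Rees lemma to this syzygy. -/
theorem exists_pull_subPow_eq_zero [IsNoetherianRing R] (I : HomogeneousIdeal 𝒜) {N : GrMod 𝒜}
    (hN : ∀ r ∈ I.toIdeal, ∀ y : N.carrier, r • y = 0) (i : ℕ) :
    ∀ {L : GrMod 𝒜} [Module.Finite R L.carrier] (α : Ext L N i),
      ∃ s, pull (subPowι I L s) α = 0 := by
  induction i with
  | zero =>
    intro L _ α
    obtain ⟨f, rfl⟩ := (Ext.mk₀_bijective _ _).2 α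
    refine ⟨1, ?_⟩
    rw [pull_def, Ext.mk₀_comp_mk₀, Ext.mk₀_eq_zero_iff]
    refine ext_apply fun x => ?_
    have hle : I.toIdeal ^ 1 • (⊤ : Submodule R L.carrier) ≤ LinearMap.ker f.lin := by
      rw [pow_one, Submodule.smul_le]
      intro r hr y _
      rw [LinearMap.mem_ker, map_smul, hN r hr]
    exact hle x.2
  | succ i ih =>
    intro L _ α
    obtain ⟨P, g, _, _, hg⟩ := L.exists_projective_cover
    have := P.projective_of_carrier
    have hS := subι_ker_shortExact g hg
    obtain ⟨β, rfl⟩ := exists_connecting_eq hS α (Ext.eq_zero_of_projective _)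
    obtain ⟨c, hc⟩ := ih (L := P.sub _ (isHomog_ker g)) β
    obtain ⟨k, hk⟩ := I.toIdeal.exists_pow_inf_eq_pow_smul (LinearMap.ker g.lin)
    refine ⟨c + k, ?_⟩
    have hmap : (I.toIdeal ^ (c + k) • (⊤ : Submodule R P.carrier)).map g.lin =
        I.toIdeal ^ (c + k) • (⊤ : Submodule R L.carrier) := by
      rw [Submodule.map_smul'', Submodule.map_top, LinearMap.range_eq_top.2 hg]
    -- The sequence `0 → K ∩ I ^ s P → I ^ s P → I ^ s L → 0` maps to `0 → K → P → L → 0`, and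
    -- `K ∩ I ^ s P` lies in `I ^ c K` for `s = c + k`.
    let g' : subPow I P (c + k) ⟶ subPow I L (c + k) :=
      subLift _ _ (subPowι I P (c + k) ≫ g) fun x => by
        change g.lin x.1 ∈ I.toIdeal ^ (c + k) • (⊤ : Submodule R L.carrier)
        rw [← hmap]
        exact ⟨x.1, x.2, rfl⟩
    have hg' : Function.Surjective g'.lin := by
      rintro ⟨y, hy⟩
      change y ∈ I.toIdeal ^ (c + k) • (⊤ : Submodule R L.carrier) at hy
      rw [← hmap] at hy
      obtain ⟨x, hx, rfl⟩ := hy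
      exact ⟨⟨x, hx⟩, rfl⟩
    have hker : ∀ x : (LinearMap.ker g'.lin), g.lin x.1.1 = 0 := fun x =>
      congrArg Subtype.val x.2
    have hS' := subι_ker_shortExact g' hg'
    let τ : (subPow I P (c + k)).sub _ (isHomog_ker g') ⟶ P.sub _ (isHomog_ker g) :=
      subLift _ _ (GrMod.subι _ _ _ ≫ subPowι I P (c + k)) hker
    let φ : ShortComplex.mk _ _ (subι_ker_comp g') ⟶ ShortComplex.mk _ _ (subι_ker_comp g) :=
      { τ₁ := τ
        τ₂ := subPowι I P (c + k)
        τ₃ := subPowι I L (c + k)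
        comm₁₂ := rfl
        comm₂₃ := rfl }
    have hτ : pull τ β = 0 := by
      refine pull_eq_zero_of_range_le (I := I) τ (fun x => ?_) hc
      refine mem_smul_top_of_coe_mem _ ?_
      have h1 : x.1.1 ∈ I.toIdeal ^ (c + k) • (⊤ : Submodule R P.carrier) ⊓ LinearMap.ker g.lin :=
        ⟨x.1.2, hker x⟩
      rw [hk _ (Nat.le_add_left k c), Nat.add_sub_cancel] at h1
      exact Submodule.smul_mono le_rfl inf_le_right h1
    exact (connecting_pull hS' hS φ β).symm.trans
      ((congrArg (connecting hS') hτ).trans (map_zero (connecting hS')))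

/-- The map `H^i_I(M, N) → Ext^i(M, N)` induced by the projections `M → M / I ^ t M`. -/
def limExt.toExt (I : HomogeneousIdeal 𝒜) (M N : GrMod 𝒜) (i : ℕ) :
    limExt I M N i →ₗ[𝒜 0] Ext M N i :=
  Module.DirectLimit.lift (𝒜 0) ℕ _ _ (fun t => pull (quotPowπ I M t)) fun _ _ h α =>
    (pull_pull _ _ α).trans (by rw [quotPowπ_comp])

theorem limExt.toExt_of {I : HomogeneousIdeal 𝒜} {M N : GrMod 𝒜} {i t : ℕ}
    (α : Ext (quotPow I M t) N i) :
    limExt.toExt I M N i (limExt.of I M N i t α) = pull (quotPowπ I M t) α :=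
  Module.DirectLimit.lift_of _ _ _

/-- If `I N = 0`, then `H^i_I(M, N)` embeds into `Ext^i(M, N)`. -/
theorem limExt.toExt_injective_of_torsion [IsNoetherianRing R] (I : HomogeneousIdeal 𝒜)
    (M : GrMod 𝒜) [Module.Finite R M.carrier] {N : GrMod 𝒜}
    (hN : ∀ r ∈ I.toIdeal, ∀ y : N.carrier, r • y = 0) (i : ℕ) :
    Function.Injective (limExt.toExt I M N i) := by
  rw [← LinearMap.ker_eq_bot, LinearMap.ker_eq_bot']
  intro z hz
  obtain ⟨t, α, rfl⟩ := z.exists_of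
  rw [limExt.toExt_of] at hz
  have hS := subι_quotπ_shortExact M _ (M.isHomog_smul_top (idealPow I t))
  cases i with
  | zero =>
    have : Epi (quotPowπ I M t) := hS.epi_g
    rw [pull_injective_of_epi (quotPowπ I M t) (hz.trans (map_zero _).symm), map_zero]
  | succ i =>
    obtain ⟨β, rfl⟩ := exists_connecting_eq hS α hz
    obtain ⟨s, hs⟩ := exists_pull_subPow_eq_zero I hN i
      (L := M.sub _ (M.isHomog_smul_top (idealPow I t))) β
    refine (limExt.of_eq_zero_iff _).2 ⟨s + t, Nat.le_add_left t s, ?_⟩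
    have hle : I.toIdeal ^ (s + t) • (⊤ : Submodule R M.carrier) ≤
        I.toIdeal ^ t • (⊤ : Submodule R M.carrier) :=
      Submodule.smul_mono_left (Ideal.pow_le_pow_right (Nat.le_add_left t s))
    -- `I ^ (s + t) M` is contained in `I ^ s (I ^ t M)`, on which `β` restricts to zero.
    have hS' := subι_quotπ_shortExact M _ (M.isHomog_smul_top (idealPow I (s + t)))
    let τ : subPow I M (s + t) ⟶ subPow I M t :=
      subLift _ _ (subPowι I M (s + t)) fun x => hle x.2
    let φ : ShortComplex.mk _ _ (M.subι_comp_quotπ _ (M.isHomog_smul_top (idealPow I (s + t)))) ⟶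
        ShortComplex.mk _ _ (M.subι_comp_quotπ _ (M.isHomog_smul_top (idealPow I t))) :=
      { τ₁ := τ
        τ₂ := 𝟙 M
        τ₃ := quotPowMap I M (Nat.le_add_left t s)
        comm₁₂ := rfl
        comm₂₃ := rfl }
    have hτ : pull τ β = 0 := by
      refine pull_eq_zero_of_range_le (I := I) τ (fun x => ?_) hs
      refine mem_smul_top_of_coe_mem _ ?_
      have hx : x.1 ∈ I.toIdeal ^ (s + t) • (⊤ : Submodule R M.carrier) := x.2
      rwa [pow_add, Submodule.mul_smul] at hx
    exact (connecting_pull hS' hS φ β).symm.trans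
      ((congrArg (connecting hS') hτ).trans (map_zero (connecting hS')))

end

section

variable {R : Type u} [CommRing R] {𝒜 : ℕ → AddSubgroup R}

/-! ### Dévissage of finitely generated graded modules -/

theorem isHomog_span_singleton [GradedRing 𝒜] (M : GrMod 𝒜) {k : ℤ} {m : M.carrier}
    (hm : m ∈ M.gr k) : M.IsHomog (Submodule.span R {m}) := by
  intro n x hx
  obtain ⟨r, rfl⟩ := Submodule.mem_span_singleton.1 hx
  induction r using DirectSum.Decomposition.inductionOn 𝒜 with
  | zero => simp
  | add a b ha hb =>
    rw [add_smul, map_add]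
    exact add_mem (ha (Submodule.mem_span_singleton.2 ⟨a, rfl⟩))
      (hb (Submodule.mem_span_singleton.2 ⟨b, rfl⟩))
  | @homogeneous i r =>
    have h := M.smul_mem r.2 hm
    by_cases hn : (i : ℤ) + k = n
    · subst hn
      rwa [M.proj_of_mem h]
    · rw [M.proj_of_mem_ne hn h]
      exact zero_mem _

theorem exists_homogeneous_ne_zero (M : GrMod 𝒜) [Nontrivial M.carrier] :
    ∃ k, ∃ m ∈ M.gr k, m ≠ 0 := by
  by_contra! h
  have h0 : ∀ x : M.carrier, x = 0 := fun x => M.induction_gr (P := fun x => x = 0) rfl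
    (fun x y hx hy => by rw [hx, hy, add_zero]) h x
  obtain ⟨x, hx⟩ := exists_ne (0 : M.carrier)
  exact hx (h0 x)

theorem mem_irrelevant_of_pos [GradedRing 𝒜] {d : ℕ} (hd : 0 < d) {r : R} (hr : r ∈ 𝒜 d) :
    r ∈ (HomogeneousIdeal.irrelevant 𝒜).toIdeal := by
  change r ∈ HomogeneousIdeal.irrelevant 𝒜
  rw [HomogeneousIdeal.mem_irrelevant_iff, GradedRing.proj_apply,
    DirectSum.decompose_of_mem_ne 𝒜 hr hd.ne']

theorem smul_eq_zero_of_mem_irrelevant [GradedRing 𝒜] {M : Type*} [AddCommGroup M] [Module R M]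
    {m : M} (h : ∀ d, 0 < d → ∀ r ∈ 𝒜 d, r • m = 0) {r : R}
    (hr : r ∈ (HomogeneousIdeal.irrelevant 𝒜).toIdeal) : r • m = 0 := by
  classical
  change r ∈ HomogeneousIdeal.irrelevant 𝒜 at hr
  rw [HomogeneousIdeal.mem_irrelevant_iff, GradedRing.proj_apply] at hr
  rw [← DirectSum.sum_support_decompose 𝒜 r, Finset.sum_smul]
  refine Finset.sum_eq_zero fun i _ => ?_
  rcases Nat.eq_zero_or_pos i with rfl | hi
  · rw [hr, zero_smul]
  · exact h i hi _ (SetLike.coe_mem _)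

/-- A property of graded modules that is stable under extensions holds for all finitely generated
graded modules if it holds for those that are killed by `R₊` and for those on which some
homogeneous element of positive degree is regular: a nonzero homogeneous element `m` whose annihilator
is maximal among the annihilators of such elements generates a submodule of one of these two kinds,
since `r m ≠ 0` implies that `r m` and `m` have the same annihilator. -/
theorem devissage [GradedRing 𝒜] [IsNoetherianRing R] (Φ : GrMod 𝒜 → Prop)
    (hext : ∀ {S : ShortComplex (GrMod 𝒜)}, S.ShortExact → Φ S.X₁ → Φ S.X₃ → Φ S.X₂)
    (htors : ∀ (N : GrMod 𝒜) [Module.Finite R N.carrier],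
      (∀ r ∈ (HomogeneousIdeal.irrelevant 𝒜).toIdeal, ∀ y : N.carrier, r • y = 0) → Φ N)
    (hreg : ∀ (N : GrMod 𝒜) [Module.Finite R N.carrier] (d : ℕ) (r : R), 0 < d → r ∈ 𝒜 d →
      (∀ y : N.carrier, r • y = 0 → y = 0) → Φ N)
    (N : GrMod 𝒜) [Module.Finite R N.carrier] : Φ N := by
  suffices h : ∀ J : Submodule R N.carrier, ∀ (N' : GrMod 𝒜) (g : N ⟶ N'),
      Function.Surjective g.lin → LinearMap.ker g.lin = J → Φ N' from
    h _ N (𝟙 N) Function.surjective_id rfl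
  intro J
  induction J using IsNoetherian.induction with
  | _ J ih =>
  intro N' g hg hJ
  have hfin : Module.Finite R N'.carrier := Module.Finite.of_surjective g.lin hg
  rcases subsingleton_or_nontrivial N'.carrier with hs | hs
  · exact htors N' fun r _ y => Subsingleton.elim _ _
  obtain ⟨k₀, m₀, hm₀, hne₀⟩ := N'.exists_homogeneous_ne_zero
  obtain ⟨_, ⟨k, m, hm, hne, rfl⟩, hmax⟩ := set_has_maximal_iff_noetherian.2
    (inferInstanceAs (IsNoetherian R R))
    {p : Ideal R | ∃ k, ∃ m ∈ N'.gr k, m ≠ 0 ∧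
      p = LinearMap.ker (LinearMap.toSpanSingleton R N'.carrier m)}
    ⟨_, k₀, m₀, hm₀, hne₀, rfl⟩
  have hK := N'.isHomog_span_singleton hm
  refine hext (N'.subι_quotπ_shortExact _ hK) ?_ ?_
  · change Φ (N'.sub _ hK)
    by_cases h : ∀ d, 0 < d → ∀ r ∈ 𝒜 d, r • m = 0
    · refine htors _ fun r hr y => Subtype.ext ?_
      obtain ⟨s, hs⟩ := Submodule.mem_span_singleton.1 y.2
      change r • y.1 = 0
      rw [← hs, smul_comm, smul_eq_zero_of_mem_irrelevant h hr, smul_zero]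
    · push Not at h
      obtain ⟨d, hd, r, hr, hrm⟩ := h
      refine hreg _ d r hd hr fun y hy => Subtype.ext ?_
      obtain ⟨s, hs⟩ := Submodule.mem_span_singleton.1 y.2
      have hy' : r • y.1 = 0 := congrArg Subtype.val hy
      change y.1 = 0
      rw [← hs] at hy' ⊢
      by_contra hsm
      refine hmax _ ⟨_, r • m, N'.smul_mem hr hm, hrm, rfl⟩ (lt_of_le_not_ge ?_ ?_)
      · intro a ha
        rw [LinearMap.mem_ker, LinearMap.toSpanSingleton_apply] at ha ⊢
        rw [smul_comm, ha, smul_zero]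
      · intro hle
        refine hsm (hle ?_)
        rw [LinearMap.mem_ker, LinearMap.toSpanSingleton_apply, smul_comm, hy']
  · refine ih _ ?_ _ (g ≫ N'.quotπ _ hK) ((Submodule.mkQ_surjective _).comp hg) rfl
    refine lt_of_le_not_ge ?_ ?_
    · rw [← hJ]
      intro x hx
      rw [LinearMap.mem_ker] at hx ⊢
      rw [comp_lin_apply, hx, map_zero]
    · intro hle
      obtain ⟨y, rfl⟩ := hg m
      refine hne ?_
      rw [← LinearMap.mem_ker, hJ]
      refine hle ?_
      rw [LinearMap.mem_ker, comp_lin_apply]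
      exact (Submodule.Quotient.mk_eq_zero _).2 (Submodule.mem_span_singleton_self _)

theorem gr_eventually_eq_bot [GradedRing 𝒜] (N : GrMod 𝒜) [Module.Finite R N.carrier]
    (hN : ∀ r ∈ (HomogeneousIdeal.irrelevant 𝒜).toIdeal, ∀ y : N.carrier, r • y = 0) :
    ∃ k : ℤ, ∀ n, k ≤ n → N.gr n = ⊥ := by
  obtain ⟨s, hs, hspan⟩ := N.exists_homogeneous_generators
  choose d hd using fun m : s => hs m m.2
  obtain ⟨b, hb⟩ := (Set.finite_range d).bddAbove
  refine ⟨b + 1, fun n hn => ?_⟩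
  have key : ∀ y ∈ Submodule.span R (s : Set N.carrier), ∀ r : R, N.proj n (r • y) = 0 := by
    intro y hy
    induction hy using Submodule.span_induction with
    | mem y hy =>
      intro r
      have hdy : d ⟨y, hy⟩ ≤ b := hb ⟨_, rfl⟩
      induction r using DirectSum.Decomposition.inductionOn 𝒜 with
      | zero => simp
      | add a c ha hc => rw [add_smul, map_add, ha, hc, add_zero]
      | @homogeneous i r =>
        rcases Nat.eq_zero_or_pos i with rfl | hi
        · exact N.proj_of_mem_ne (by omega) (N.smul_zero_mem r (hd ⟨y, hy⟩))
        · rw [hN _ (mem_irrelevant_of_pos hi r.2), map_zero]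
    | zero => simp
    | add y z _ _ hy hz =>
      intro r
      rw [smul_add, map_add, hy, hz, add_zero]
    | smul a y _ hy =>
      intro r
      rw [smul_smul]
      exact hy _
  rw [eq_bot_iff]
  intro x hx
  have := key x (hspan ▸ Submodule.mem_top) 1
  rw [one_smul, N.proj_of_mem hx] at this
  exact this

end

section

variable {R : Type u} [CommRing R] {𝒜 : ℕ → AddSubgroup R}

/-! ### Finiteness of generalized local cohomology with respect to the irrelevant ideal -/

theorem shift_shift (M : GrMod 𝒜) (d n : ℤ) : (M.shift d).shift n = M.shift (d + n) := by
  have h : ((M.shift d).shift n).gr = (M.shift (d + n)).gr :=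
    funext fun k => congrArg M.gr (add_assoc d n k).symm
  unfold shift at h ⊢
  simp only at h
  simp only [h]

/-- Shifting a morphism of graded modules. -/
def shiftMap {M N : GrMod 𝒜} (f : M ⟶ N) (n : ℤ) : M.shift n ⟶ N.shift n :=
  ⟨f.lin, fun k x hx => f.map_mem (n + k) x hx⟩

theorem shift_shortExact {S : ShortComplex (GrMod 𝒜)} (hS : S.ShortExact) (n : ℤ) :
    (ShortComplex.mk (shiftMap S.f n) (shiftMap S.g n)
      (ext_apply fun x => congrArg (fun f : S.X₁ ⟶ S.X₃ => f.lin x) S.zero)).ShortExact := by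
  have := hS.mono_f
  have := hS.epi_g
  refine shortExact_of_exact (shiftMap S.f n) (shiftMap S.g n) (injective_of_mono S.f) ?_
    (surjective_of_epi S.g)
  exact (ShortComplex.ShortExact.moduleCat_exact_iff_function_exact _).1
    ((hS.map_of_exact (forgetGr 𝒜)).exact)

theorem isNoetherian_of_exact {A M N P : Type*} [Ring A] [AddCommGroup M] [AddCommGroup N]
    [AddCommGroup P] [Module A M] [Module A N] [Module A P] [IsNoetherian A M] [IsNoetherian A P]
    (f : M →ₗ[A] N) (g : N →ₗ[A] P) (h : ∀ z, g z = 0 → ∃ y, f y = z) : IsNoetherian A N := by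
  let f' : (LinearMap.ker g).comap f →ₗ[A] N := f.comp (Submodule.subtype _)
  refine isNoetherian_of_range_eq_ker f' g ?_
  ext z
  constructor
  · rintro ⟨y, rfl⟩
    exact y.2
  · intro hz
    obtain ⟨y, rfl⟩ := h z hz
    exact ⟨⟨y, hz⟩, rfl⟩

variable [GradedRing 𝒜]

/-- The components of `H^i_{R₊}(M, N)` are Noetherian over the degree zero part of the ring, and
those of large degree vanish. -/
def FiniteComponents (M : GrMod 𝒜) (i : ℕ) (N : GrMod 𝒜) : Prop :=
  (∀ n, IsNoetherian (𝒜 0) (limExt (HomogeneousIdeal.irrelevant 𝒜) M (N.shift n) i)) ∧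
    ∃ n₀ : ℤ, ∀ n, n₀ ≤ n →
      ∀ z : limExt (HomogeneousIdeal.irrelevant 𝒜) M (N.shift n) i, z = 0

theorem FiniteComponents.of_shortExact {M : GrMod 𝒜} {i : ℕ} {S : ShortComplex (GrMod 𝒜)}
    (hS : S.ShortExact) (h₁ : FiniteComponents M i S.X₁) (h₃ : FiniteComponents M i S.X₃) :
    FiniteComponents M i S.X₂ := by
  obtain ⟨hn₁, n₁, hz₁⟩ := h₁
  obtain ⟨hn₃, n₃, hz₃⟩ := h₃
  have hex := fun n => limExt.exists_map_f_eq (I := HomogeneousIdeal.irrelevant 𝒜) (M := M)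
    (i := i) (shift_shortExact hS n)
  refine ⟨fun n => ?_, max n₁ n₃, fun n hn z => ?_⟩
  · have := hn₁ n
    have := hn₃ n
    exact isNoetherian_of_exact _ _ (hex n)
  · obtain ⟨y, rfl⟩ := hex n z (hz₃ n ((le_max_right _ _).trans hn) _)
    have hy : y = 0 := hz₁ n ((le_max_left _ _).trans hn) y
    rw [hy, map_zero]

theorem FiniteComponents.of_torsion [IsNoetherianRing R] (M : GrMod 𝒜) [Module.Finite R M.carrier]
    (i : ℕ) (N : GrMod 𝒜) [Module.Finite R N.carrier]
    (hN : ∀ r ∈ (HomogeneousIdeal.irrelevant 𝒜).toIdeal, ∀ y : N.carrier, r • y = 0) :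
    FiniteComponents M i N := by
  have hemb := fun n => limExt.toExt_injective_of_torsion (HomogeneousIdeal.irrelevant 𝒜) M
    (N := N.shift n) hN i
  obtain ⟨k, hk⟩ := N.gr_eventually_eq_bot hN
  obtain ⟨n₀, hn₀⟩ := N.ext_shift_eventually_zero hk i M
  refine ⟨fun n => ?_, n₀, fun n hn z => ?_⟩
  · have := isNoetherian_ext (N.shift n) i M
    exact isNoetherian_of_injective _ (hemb n)
  · exact hemb n ((hn₀ n hn _).trans (map_zero _).symm)

/-- Multiplication by a homogeneous element of degree `d`, as a morphism `N → N(d)`. -/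
def mulMap (N : GrMod 𝒜) {d : ℕ} {r : R} (hr : r ∈ 𝒜 d) : N ⟶ N.shift d where
  lin := r • LinearMap.id
  map_mem _ _ hx := N.smul_mem hr hx

theorem mapExactFunctor_push_mulMap {X N : GrMod 𝒜} {d : ℕ} {r : R} (hr : r ∈ 𝒜 d) {i : ℕ}
    (n : ℤ) (α : Ext X (N.shift n) i) :
    (push (shiftMap (N.mulMap hr) n) α).mapExactFunctor (forgetGr 𝒜) =
      r • α.mapExactFunctor (forgetGr 𝒜) := by
  rw [push_def, Ext.mapExactFunctor_comp, Ext.mapExactFunctor_mk₀, Ext.smul_eq_comp_mk₀]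
  rfl

theorem smul_ext_eq_zero {X Y : ModuleCat.{u} R} {r : R} (hr : ∀ x : X, r • x = 0) {i : ℕ}
    (α : Ext X Y i) : r • α = 0 := by
  have h : r • 𝟙 X = 0 := by
    ext x
    exact hr x
  rw [← Ext.mk₀_id_comp α, ← Ext.smul_comp, ← Ext.mk₀_smul, h, Ext.mk₀_zero, Ext.zero_comp]

theorem pow_smul_quotPow (I : HomogeneousIdeal 𝒜) (M : GrMod 𝒜) {r : R} (hr : r ∈ I.toIdeal)
    (t : ℕ) (y : (quotPow I M t).carrier) : r ^ t • y = 0 := by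
  obtain ⟨x, rfl⟩ := Submodule.mkQ_surjective _ y
  exact (Submodule.Quotient.mk_eq_zero _).2
    (Submodule.smul_mem_smul (Ideal.pow_mem_pow hr t) Submodule.mem_top)

theorem FiniteComponents.of_regular [IsNoetherianRing R] (M : GrMod 𝒜)
    [Module.Finite R M.carrier] (i : ℕ) (N : GrMod 𝒜) [Module.Finite R N.carrier]
    (ih : ∀ j, j + 1 = i → ∀ (N' : GrMod 𝒜) [Module.Finite R N'.carrier], FiniteComponents M j N')
    (d : ℕ) (r : R) (hd : 0 < d) (hr : r ∈ 𝒜 d) (hreg : ∀ y : N.carrier, r • y = 0 → y = 0) :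
    FiniteComponents M i N := by
  let μ := N.mulMap hr
  have hμ : Function.Injective μ.lin := by
    rw [← LinearMap.ker_eq_bot, LinearMap.ker_eq_bot']
    exact hreg
  let C := (N.shift d).quot _ (isHomog_range μ)
  let π : N.shift d ⟶ C := (N.shift d).quotπ _ (isHomog_range μ)
  have hS := shortExact_of_exact μ π hμ (fun x => by
      change (LinearMap.range μ.lin).mkQ x = 0 ↔ x ∈ Set.range μ.lin
      simp) (Submodule.mkQ_surjective _)
  -- The kernel of multiplication by `r` on `H^i(N)` is the image of `H^(i-1)(C)`.
  have hker : ∃ n₀ : ℤ, ∀ n, n₀ ≤ n →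
      Function.Injective (limExt.map (HomogeneousIdeal.irrelevant 𝒜) M i (shiftMap μ n)) := by
    cases i with
    | zero =>
      refine ⟨0, fun n _ => ?_⟩
      have : Mono (shiftMap μ n) := (shift_shortExact hS n).mono_f
      exact limExt.map_injective_of_mono _
    | succ i =>
      obtain ⟨-, n₀, hn₀⟩ := ih i rfl C
      refine ⟨n₀, fun n hn => ?_⟩
      rw [← LinearMap.ker_eq_bot, LinearMap.ker_eq_bot']
      intro z hz
      obtain ⟨y, rfl⟩ := limExt.exists_δ_eq (shift_shortExact hS n) z hz
      have hy : y = 0 := hn₀ n hn y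
      rw [hy, map_zero]
  have hnoeth : ∀ n, IsNoetherian (𝒜 0)
      (limExt (HomogeneousIdeal.irrelevant 𝒜) M ((N.shift d).shift n) i) →
      IsNoetherian (𝒜 0) (limExt (HomogeneousIdeal.irrelevant 𝒜) M (N.shift n) i) := by
    intro n hn
    cases i with
    | zero =>
      have : Mono (shiftMap μ n) := (shift_shortExact hS n).mono_f
      exact isNoetherian_of_injective _ (limExt.map_injective_of_mono (shiftMap μ n))
    | succ i =>
      have h := (ih i rfl C).1 n
      exact isNoetherian_of_exact (limExt.δ _ M i (shift_shortExact hS n))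
        (limExt.map _ M (i + 1) (shiftMap μ n))
        (limExt.exists_δ_eq (shift_shortExact hS n))
  obtain ⟨n₀, hn₀⟩ := hker
  -- Local cohomology is `r`-torsion, so it vanishes where multiplication by `r` is injective.
  have hzero : ∀ (t k : ℕ) (n : ℤ), n₀ ≤ n → ∀ X : GrMod 𝒜, X = N.shift n →
      ∀ α : Ext (quotPow (HomogeneousIdeal.irrelevant 𝒜) M t) X i,
        r ^ k • α.mapExactFunctor (forgetGr 𝒜) = 0 → limExt.of _ M X i t α = 0 := by
    intro t k
    have hfin : Module.Finite R (quotPow (HomogeneousIdeal.irrelevant 𝒜) M t).carrier :=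
      inferInstanceAs (Module.Finite R (M.quot _ _).carrier)
    induction k with
    | zero =>
      intro n hn X hX α hα
      rw [pow_zero, one_smul] at hα
      rw [mapExactFunctor_forgetGr_injective i α hα, map_zero]
    | succ k ihk =>
      rintro n hn _ rfl α hα
      apply hn₀ n hn
      rw [limExt.map_of, map_zero]
      refine ihk (d + n) (by omega) _ (shift_shift N d n) _ ?_
      rw [pow_succ, mul_smul] at hα
      rw [mapExactFunctor_push_mulMap]
      exact hα
  have hvan : ∀ n, n₀ ≤ n →
      ∀ z : limExt (HomogeneousIdeal.irrelevant 𝒜) M (N.shift n) i, z = 0 := by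
    intro n hn z
    obtain ⟨t, α, rfl⟩ := z.exists_of
    exact hzero t t n hn _ rfl α
      (smul_ext_eq_zero (pow_smul_quotPow _ M (mem_irrelevant_of_pos hd hr) t) _)
  refine ⟨fun n => ?_, n₀, hvan⟩
  -- Descending induction on the degree in steps of size `d`, starting where everything vanishes.
  have hdesc : ∀ (k : ℕ) (n : ℤ), n₀ ≤ n + k →
      IsNoetherian (𝒜 0) (limExt (HomogeneousIdeal.irrelevant 𝒜) M (N.shift n) i) := by
    intro k
    induction k with
    | zero =>
      intro n hn
      have : Subsingleton (limExt (HomogeneousIdeal.irrelevant 𝒜) M (N.shift n) i) :=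
        subsingleton_of_forall_eq 0 (hvan n (by omega))
      infer_instance
    | succ k ihk =>
      intro n hn
      refine hnoeth n ?_
      rw [shift_shift]
      exact ihk _ (by omega)
  exact hdesc (n₀ - n).toNat n (by omega)

/-- The components of `H^i_{R₊}(M, N)` are Noetherian over `R₀` and vanish in large degrees. By
dévissage in `N`, the class is reduced to modules killed by `R₊`, where `H^i_{R₊}(M, N)` embeds into
`Ext^i(M, N)`, and to modules with a regular homogeneous element of positive degree, where one
uses induction on `i`. -/
theorem finiteComponents [IsNoetherianRing R] (M : GrMod 𝒜) [Module.Finite R M.carrier] (i : ℕ) :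
    ∀ (N : GrMod 𝒜) [Module.Finite R N.carrier], FiniteComponents M i N := by
  induction i with
  | zero =>
    exact fun N _ => devissage (FiniteComponents M 0) FiniteComponents.of_shortExact
      (fun N _ => FiniteComponents.of_torsion M 0 N)
      (fun N _ => FiniteComponents.of_regular M 0 N (fun j hj => by omega)) N
  | succ i ih =>
    exact fun N _ => devissage (FiniteComponents M (i + 1)) FiniteComponents.of_shortExact
      (fun N _ => FiniteComponents.of_torsion M (i + 1) N)
      (fun N _ => FiniteComponents.of_regular M (i + 1) N (fun j hj => by
        obtain rfl : j = i := by omega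
        exact ih)) N

end

section

variable {R : Type u} [CommRing R] {𝒜 : ℕ → AddSubgroup R} [GradedRing 𝒜]

/-! ### The sequence `0 → c L → L → L / c L → 0` -/

/-- The submodule `c L` of a graded module `L`, for an element `c` of degree zero. -/
def smulSubmodule (c : 𝒜 0) (L : GrMod 𝒜) : Submodule R L.carrier :=
  LinearMap.range (Hom.lin (c • 𝟙 L))

theorem mem_smulSubmodule {c : 𝒜 0} {L : GrMod 𝒜} {y : L.carrier} :
    y ∈ smulSubmodule c L ↔ ∃ l : L.carrier, (c : R) • l = y := Iff.rfl

theorem isHomog_smulSubmodule (c : 𝒜 0) (L : GrMod 𝒜) : L.IsHomog (smulSubmodule c L) :=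
  isHomog_range _

/-- The graded module `c L`. -/
def smulSub (c : 𝒜 0) (L : GrMod 𝒜) : GrMod 𝒜 := L.sub _ (isHomog_smulSubmodule c L)

/-- The graded module `L / c L`. -/
def smulQuot (c : 𝒜 0) (L : GrMod 𝒜) : GrMod 𝒜 := L.quot _ (isHomog_smulSubmodule c L)

/-- The inclusion `c L → L`. -/
def smulSubι (c : 𝒜 0) (L : GrMod 𝒜) : smulSub c L ⟶ L := L.subι _ _

/-- The projection `L → L / c L`. -/
def smulQuotπ (c : 𝒜 0) (L : GrMod 𝒜) : L ⟶ smulQuot c L := L.quotπ _ _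

theorem smulSubι_comp (c : 𝒜 0) (L : GrMod 𝒜) : smulSubι c L ≫ smulQuotπ c L = 0 :=
  L.subι_comp_quotπ _ _

theorem smul_shortExact (c : 𝒜 0) (L : GrMod 𝒜) :
    (ShortComplex.mk _ _ (smulSubι_comp c L)).ShortExact :=
  L.subι_quotπ_shortExact _ _

instance (c : 𝒜 0) (L : GrMod 𝒜) : Mono (smulSubι c L) := (smul_shortExact c L).mono_f

instance (c : 𝒜 0) (L : GrMod 𝒜) : Epi (smulQuotπ c L) := (smul_shortExact c L).epi_g

theorem smulQuotπ_smul (c : 𝒜 0) (L : GrMod 𝒜) (l : L.carrier) :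
    (smulQuotπ c L).lin ((c : R) • l) = 0 :=
  (Submodule.Quotient.mk_eq_zero _).2 (mem_smulSubmodule.2 ⟨l, rfl⟩)

section
variable {c c' c'' : 𝒜 0} {L L' L'' : GrMod 𝒜}

/-- The map `c L → c' L'` induced by `φ : L ⟶ L'` if `c'` divides `c`. -/
def smulSubMap (φ : L ⟶ L') (h : c' ∣ c) : smulSub c L ⟶ smulSub c' L' :=
  subLift _ _ (smulSubι c L ≫ φ) (by
    rintro ⟨_, l, rfl⟩
    obtain ⟨e, rfl⟩ := h
    refine mem_smulSubmodule.2 ⟨(e : R) • φ.lin l, ?_⟩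
    change _ = φ.lin (((c' : R) * (e : R)) • l)
    rw [map_smul, mul_smul])

theorem smulSubMap_ι (φ : L ⟶ L') (h : c' ∣ c) :
    smulSubMap φ h ≫ smulSubι c' L' = smulSubι c L ≫ φ :=
  subLift_subι _ _ _ _

/-- The map `L / c L → L' / c' L'` induced by `φ : L ⟶ L'` if `c'` divides `c`. -/
def smulQuotMap (φ : L ⟶ L') (h : c' ∣ c) : smulQuot c L ⟶ smulQuot c' L' :=
  quotDesc _ _ (φ ≫ smulQuotπ c' L') (by
    rintro _ ⟨l, rfl⟩
    obtain ⟨e, rfl⟩ := h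
    rw [LinearMap.mem_ker, comp_lin_apply]
    change (smulQuotπ c' L').lin (φ.lin (((c' : R) * (e : R)) • l)) = 0
    rw [map_smul, mul_smul, smulQuotπ_smul])

theorem smulQuotπ_map (φ : L ⟶ L') (h : c' ∣ c) :
    smulQuotπ c L ≫ smulQuotMap φ h = φ ≫ smulQuotπ c' L' :=
  quotπ_quotDesc _ _ _ _

theorem connecting_smulSubMap (φ : L ⟶ L') (h : c' ∣ c) {N : GrMod 𝒜} {i : ℕ}
    (β : Ext (smulSub c' L') N i) :
    connecting (smul_shortExact c L) (pull (smulSubMap φ h) β) =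
      pull (smulQuotMap φ h) (connecting (smul_shortExact c' L') β) := by
  let f : ShortComplex.mk _ _ (smulSubι_comp c L) ⟶ ShortComplex.mk _ _ (smulSubι_comp c' L') :=
    { τ₁ := smulSubMap φ h
      τ₂ := φ
      τ₃ := smulQuotMap φ h
      comm₁₂ := smulSubMap_ι φ h
      comm₂₃ := (smulQuotπ_map φ h).symm }
  exact connecting_pull (smul_shortExact c L) (smul_shortExact c' L') f β

theorem smul_ext_smulQuot {N : GrMod 𝒜} {i : ℕ} (α : Ext (smulQuot c L) N i) : c • α = 0 := by
  have h : c • 𝟙 (smulQuot c L) = 0 := by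
    rw [← cancel_epi (smulQuotπ c L), comp_zero]
    exact ext_apply fun l => smulQuotπ_smul c L l
  rw [← pull_smul_id, h, pull_zero]

end

/-- Multiplication by `c` as a map `e L → (e c) L`. -/
def smulSubMul (e c : 𝒜 0) (L : GrMod 𝒜) : smulSub e L ⟶ smulSub (e * c) L :=
  subLift _ _ (c • smulSubι e L) (by
    rintro ⟨_, l, rfl⟩
    refine mem_smulSubmodule.2 ⟨l, ?_⟩
    change ((e : R) * (c : R)) • l = (c : R) • (e : R) • l
    rw [mul_comm, mul_smul])

theorem smulSubMul_ι (e c : 𝒜 0) (L : GrMod 𝒜) :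
    smulSubMul e c L ≫ smulSubι (e * c) L = c • smulSubι e L :=
  subLift_subι _ _ _ _

theorem smulSubMul_comp (e c : 𝒜 0) (L : GrMod 𝒜) :
    smulSubMul e c L ≫ smulSubMap (𝟙 L) (Dvd.intro c rfl) = c • 𝟙 (smulSub e L) := by
  rw [← cancel_mono (smulSubι e L), Category.assoc, smulSubMap_ι, Category.comp_id, smulSubMul_ι,
    Linear.smul_comp, Category.id_comp]

theorem smulSubMap_comp_mul (e c : 𝒜 0) (L : GrMod 𝒜) :
    smulSubMap (𝟙 L) (Dvd.intro c rfl) ≫ smulSubMul e c L = c • 𝟙 (smulSub (e * c) L) := by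
  rw [← cancel_mono (smulSubι (e * c) L), Category.assoc, smulSubMul_ι, Linear.comp_smul,
    smulSubMap_ι, Category.comp_id, Linear.smul_comp, Category.id_comp]

/-- On a Noetherian module, multiplication by powers of `x` is injective on `x ^ s L` for
large `s`. -/
theorem exists_isIso_smulSubMul [IsNoetherianRing R] (x : 𝒜 0) (L : GrMod 𝒜)
    [Module.Finite R L.carrier] :
    ∃ s₀, ∀ s, s₀ ≤ s → ∀ k, IsIso (smulSubMul (x ^ s) (x ^ k) L) := by
  obtain ⟨s₀, hs₀⟩ := monotone_stabilizes_iff_noetherian.2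
    (inferInstanceAs (IsNoetherian R L.carrier)) (LinearMap.iterateKer (Hom.lin (x • 𝟙 L)))
  have hpow : ∀ n (l : L.carrier), (Hom.lin (x • 𝟙 L) ^ n) l = ((x ^ n : 𝒜 0) : R) • l := by
    intro n l
    induction n with
    | zero =>
      rw [pow_zero, pow_zero]
      exact (one_smul R l).symm
    | succ n ih =>
      rw [pow_succ', Module.End.mul_apply, ih, pow_succ']
      exact (mul_smul (x : R) ((x ^ n : 𝒜 0) : R) l).symm
  have hker : ∀ n, s₀ ≤ n → ∀ l : L.carrier,
      ((x ^ n : 𝒜 0) : R) • l = 0 ↔ ((x ^ s₀ : 𝒜 0) : R) • l = 0 := by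
    intro n hn l
    rw [← hpow, ← hpow]
    have h := hs₀ n hn
    exact (SetLike.ext_iff.1 h l).symm
  refine ⟨s₀, fun s hs k => isIso_of_bijective _ ⟨?_, ?_⟩⟩
  · rw [← LinearMap.ker_eq_bot, LinearMap.ker_eq_bot']
    rintro ⟨_, l, rfl⟩ h
    have h' : ((x ^ k : 𝒜 0) : R) • ((x ^ s : 𝒜 0) : R) • l = 0 := congrArg Subtype.val h
    have h'' : ((x ^ (k + s) : 𝒜 0) : R) • l = 0 := by
      rw [pow_add]
      exact (mul_smul _ _ _).trans h'
    refine Subtype.ext ?_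
    exact (hker s hs l).2 ((hker (k + s) (by omega) l).1 h'')
  · rintro ⟨_, l, rfl⟩
    refine ⟨⟨_, l, rfl⟩, Subtype.ext ?_⟩
    change ((x ^ k : 𝒜 0) : R) • ((x ^ s : 𝒜 0) : R) • l =
      (((x ^ s : 𝒜 0) : R) * ((x ^ k : 𝒜 0) : R)) • l
    rw [mul_comm, mul_smul]

end

section

variable {R : Type u} [CommRing R] {𝒜 : ℕ → AddSubgroup R} [GradedRing 𝒜]

/-! ### Adding an element of degree zero to the ideal -/

/-- The transition maps of the tower `x ^ t (M / I ^ t M)`. -/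
def subTransition (I : HomogeneousIdeal 𝒜) (x : 𝒜 0) (M : GrMod 𝒜) {s t : ℕ} (h : s ≤ t) :
    smulSub (x ^ t) (quotPow I M t) ⟶ smulSub (x ^ s) (quotPow I M s) :=
  smulSubMap (quotPowMap I M h) (pow_dvd_pow x h)

/-- The transition maps of the tower `M / (I ^ t + (x ^ t)) M`. -/
def quotTransition (I : HomogeneousIdeal 𝒜) (x : 𝒜 0) (M : GrMod 𝒜) {s t : ℕ} (h : s ≤ t) :
    smulQuot (x ^ t) (quotPow I M t) ⟶ smulQuot (x ^ s) (quotPow I M s) :=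
  smulQuotMap (quotPowMap I M h) (pow_dvd_pow x h)

section
variable (I : HomogeneousIdeal 𝒜) (x : 𝒜 0) (M : GrMod 𝒜)

theorem subTransition_ι {s t : ℕ} (h : s ≤ t) :
    subTransition I x M h ≫ smulSubι _ _ = smulSubι _ _ ≫ quotPowMap I M h :=
  smulSubMap_ι _ _

theorem quotπ_transition {s t : ℕ} (h : s ≤ t) :
    smulQuotπ _ _ ≫ quotTransition I x M h = quotPowMap I M h ≫ smulQuotπ _ _ :=
  smulQuotπ_map _ _

theorem subTransition_comp {s t r : ℕ} (h : s ≤ t) (h' : t ≤ r) :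
    subTransition I x M h' ≫ subTransition I x M h = subTransition I x M (h.trans h') := by
  rw [← cancel_mono (smulSubι _ _), Category.assoc, subTransition_ι, ← Category.assoc,
    subTransition_ι, Category.assoc, quotPowMap_comp, subTransition_ι]

theorem quotTransition_comp {s t r : ℕ} (h : s ≤ t) (h' : t ≤ r) :
    quotTransition I x M h' ≫ quotTransition I x M h = quotTransition I x M (h.trans h') := by
  rw [← cancel_epi (smulQuotπ _ _), ← Category.assoc, quotπ_transition, Category.assoc,
    quotπ_transition, ← Category.assoc, quotPowMap_comp, quotπ_transition]

instance (t : ℕ) [Module.Finite R M.carrier] : Module.Finite R (quotPow I M t).carrier :=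
  inferInstanceAs (Module.Finite R (M.quot _ _).carrier)

/-- The `Ext`-groups of the tower `M / (I ^ t + (x ^ t)) M` have direct limit zero in all
cohomological degrees. -/
def QuotTowerAcyclic (N : GrMod 𝒜) : Prop :=
  ∀ (i t : ℕ) (α : Ext (smulQuot (x ^ t) (quotPow I M t)) N i),
    ∃ s, ∃ h : t ≤ s, pull (quotTransition I x M h) α = 0

variable {I x M}

/-- Powers of `x` act injectively on the direct limit of the `Ext`-groups of `x ^ t (M / I ^ t M)`,
as multiplication by `x ^ k` identifies `x ^ s L` with `x ^ (s + k) L` for large `s`. -/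
theorem exists_pull_subTransition_eq_zero [IsNoetherianRing R] [Module.Finite R M.carrier]
    {N : GrMod 𝒜} {i r k : ℕ} (β : Ext (smulSub (x ^ r) (quotPow I M r)) N i)
    (hβ : x ^ k • β = 0) : ∃ q, ∃ h : r ≤ q, pull (subTransition I x M h) β = 0 := by
  obtain ⟨s₀, hs₀⟩ := exists_isIso_smulSubMul x (quotPow I M r)
  let s := max s₀ r
  have hrs : r ≤ s := le_max_right _ _
  have hiso := hs₀ s (le_max_left _ _) k
  let L := quotPow I M r
  let σ := smulSubMul (x ^ s) (x ^ k) L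
  let j : smulSub (x ^ s * x ^ k) L ⟶ smulSub (x ^ s) L := smulSubMap (𝟙 L) (Dvd.intro _ rfl)
  let p : smulSub (x ^ s) L ⟶ smulSub (x ^ r) L := smulSubMap (𝟙 L) (pow_dvd_pow x hrs)
  have h0 : pull j (pull p β) = 0 := by
    have h1 : pull σ (pull j (pull p β)) = 0 := by
      rw [pull_pull, smulSubMul_comp, pull_smul_id, ← map_smul, hβ, map_zero]
    have h2 : pull (inv σ) (pull σ (pull j (pull p β))) = pull j (pull p β) := by
      rw [pull_pull, IsIso.inv_hom_id, pull_id]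
    rw [← h2, h1, map_zero]
  have hle : r ≤ s + k := hrs.trans (Nat.le_add_right s k)
  refine ⟨s + k, hle, ?_⟩
  let q : smulSub (x ^ (s + k)) (quotPow I M (s + k)) ⟶ smulSub (x ^ s * x ^ k) L :=
    smulSubMap (quotPowMap I M hle) (dvd_of_eq (pow_add x s k).symm)
  have hq : subTransition I x M hle = q ≫ j ≫ p := by
    rw [← cancel_mono (smulSubι _ _), Category.assoc, Category.assoc, smulSubMap_ι,
      Category.comp_id, smulSubMap_ι, Category.comp_id, smulSubMap_ι, subTransition_ι]
  rw [hq, ← pull_pull, ← pull_pull, h0, map_zero]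

/-- If the tower `M / (I ^ t + (x ^ t)) M` is acyclic, then multiplication by `x` is surjective on
`H^i_I(M, N)`: the latter agrees with the direct limit of the `Ext`-groups of `x ^ t (M / I ^ t M)`,
where `x` is invertible. -/
theorem QuotTowerAcyclic.smul_surjective [IsNoetherianRing R] [Module.Finite R M.carrier]
    {N : GrMod 𝒜} (hD : QuotTowerAcyclic I x M N) (i : ℕ) (w : limExt I M N i) :
    ∃ z, x • z = w := by
  obtain ⟨t, α, rfl⟩ := w.exists_of
  obtain ⟨s₀, hs₀⟩ := exists_isIso_smulSubMul x (quotPow I M t)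
  let s := max s₀ t
  have hts : t ≤ s := le_max_right _ _
  have hiso := hs₀ s (le_max_left _ _) 1
  let L := quotPow I M t
  let σ := smulSubMul (x ^ s) (x ^ 1) L
  let j : smulSub (x ^ s * x ^ 1) L ⟶ smulSub (x ^ s) L := smulSubMap (𝟙 L) (Dvd.intro _ rfl)
  -- `β₀` is the restriction of `α` to `x ^ s L`, divided by `x`.
  let β₀ : Ext (smulSub (x ^ s * x ^ 1) L) N i := pull (inv σ) (pull (smulSubι (x ^ s) L) α)
  have hβ₀ : x • β₀ = pull (smulSubι (x ^ s * x ^ 1) L) α := by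
    have h1 : j ≫ σ = x • 𝟙 _ := by
      rw [smulSubMap_comp_mul, pow_one]
    rw [← pull_smul_id, ← h1, pull_pull, Category.assoc, IsIso.hom_inv_id, Category.comp_id,
      pull_pull, smulSubMap_ι, Category.comp_id]
  have htp : t ≤ s + 1 := hts.trans (Nat.le_succ s)
  let q : smulSub (x ^ (s + 1)) (quotPow I M (s + 1)) ⟶ smulSub (x ^ s * x ^ 1) L :=
    smulSubMap (quotPowMap I M htp) (dvd_of_eq (pow_add x s 1).symm)
  -- The obstruction to extending `β₀` to `M / I ^ p M` vanishes for large `p`.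
  obtain ⟨p, hp, e⟩ := hD (i + 1) (s + 1)
    (connecting (smul_shortExact (x ^ (s + 1)) (quotPow I M (s + 1))) (pull q β₀))
  rw [quotTransition, ← connecting_smulSubMap] at e
  obtain ⟨β, hβ⟩ := exists_pull_f_eq _ _ e
  have hw : pull (smulSubι (x ^ p) (quotPow I M p))
      (x • β - pull (quotPowMap I M (htp.trans hp)) α) = 0 := by
    have hβ' : pull (smulSubι (x ^ p) (quotPow I M p)) β =
      pull (subTransition I x M hp) (pull q β₀) := hβ
    rw [map_sub, map_smul, hβ', ← map_smul, ← map_smul, hβ₀, pull_pull, pull_pull, pull_pull,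
      Category.assoc, smulSubMap_ι, ← Category.assoc, subTransition_ι, Category.assoc, quotPowMap_comp, sub_self]
  -- `x β - α` comes from the acyclic tower.
  obtain ⟨γ, hγ⟩ := exists_pull_g_eq (smul_shortExact _ _) _ hw
  obtain ⟨r, hr, e'⟩ := hD i p γ
  refine ⟨limExt.of I M N i p β, ?_⟩
  rw [← limExt.of_pull (htp.trans hp) α, ← sub_eq_zero, ← map_smul, ← map_sub,
    limExt.of_eq_zero_iff]
  refine ⟨r, hr, ?_⟩
  have hγ' : pull (smulQuotπ (x ^ p) (quotPow I M p)) γ =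
    x • β - pull (quotPowMap I M (htp.trans hp)) α := hγ
  rw [← hγ', pull_pull, ← quotπ_transition, ← pull_pull, e', map_zero]

/-- If all `H^i_I(M, N)` vanish, then the tower `M / (I ^ t + (x ^ t)) M` is acyclic: its direct
limits are those of `x ^ t (M / I ^ t M)` in the preceding cohomological degree, and `x` is
invertible on the latter while each element of the former is killed by a power of `x`. -/
theorem quotTowerAcyclic_of_limExt [IsNoetherianRing R] [Module.Finite R M.carrier] {N : GrMod 𝒜}
    (h : ∀ (i : ℕ) (w : limExt I M N i), w = 0) : QuotTowerAcyclic I x M N := by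
  intro i t α
  obtain ⟨s, hs, e⟩ := (limExt.of_eq_zero_iff (pull (smulQuotπ _ _) α)).1 (h i _)
  rw [pull_pull, ← quotπ_transition I x M hs, ← pull_pull] at e
  cases i with
  | zero => exact ⟨s, hs, pull_injective_of_epi _ (e.trans (map_zero _).symm)⟩
  | succ i =>
    obtain ⟨β, hβ⟩ := exists_connecting_eq (smul_shortExact _ _) _ e
    have hxβ : connecting (smul_shortExact _ _) (x ^ s • β) = 0 := by
      rw [map_smul, hβ]
      exact smul_ext_smulQuot _
    obtain ⟨η, hη⟩ := exists_pull_f_eq _ _ hxβ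
    obtain ⟨r, hr, eη⟩ := (limExt.of_eq_zero_iff η).1 (h i _)
    have hβr : x ^ s • pull (subTransition I x M hr) β = 0 := by
      have hη' : pull (smulSubι _ _) η = x ^ s • β := hη
      rw [← map_smul, ← hη', pull_pull, subTransition_ι, ← pull_pull, eη, map_zero]
    obtain ⟨q, hq, e'⟩ := exists_pull_subTransition_eq_zero _ hβr
    refine ⟨q, (hs.trans hr).trans hq, ?_⟩
    have hcomp : quotTransition I x M ((hs.trans hr).trans hq) =
        quotTransition I x M (hr.trans hq) ≫ quotTransition I x M hs := by
      rw [quotTransition_comp]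
    rw [hcomp, ← pull_pull, ← hβ]
    rw [pull_pull, subTransition_comp] at e'
    have e'' := connecting_smulSubMap (quotPowMap I M (hr.trans hq)) (pow_dvd_pow x (hr.trans hq)) β
    refine e''.symm.trans ?_
    refine (congrArg (connecting (smul_shortExact _ _)) e').trans (map_zero _)

end

end

section

variable {R : Type u} [CommRing R] {𝒜 : ℕ → AddSubgroup R} [GradedRing 𝒜]

/-! ### Cofinality of the towers `M / (I ^ t + (x ^ t)) M` and `M / (I + (x)) ^ t M` -/

theorem addIrrelevant_span_toIdeal (x : 𝒜 0) :
    (addIrrelevant 𝒜 (Ideal.span {x})).toIdeal =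
      Ideal.span {(x : R)} ⊔ (HomogeneousIdeal.irrelevant 𝒜).toIdeal := by
  change (Ideal.span {x}).map (algebraMap (𝒜 0) R) ⊔ _ = _
  rw [Ideal.map_span, Set.image_singleton]
  rfl

theorem coe_pow_zero (x : 𝒜 0) (t : ℕ) : ((x ^ t : 𝒜 0) : R) = (x : R) ^ t :=
  map_pow (algebraMap (𝒜 0) R) x t

section
variable (x : 𝒜 0) (M : GrMod 𝒜)

instance (I : HomogeneousIdeal 𝒜) (t : ℕ) : Epi (quotPowπ I M t) :=
  epi_of_surjective _ (Submodule.mkQ_surjective _)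

theorem quotPowπ_apply_eq_zero {I : HomogeneousIdeal 𝒜} {t : ℕ} {m : M.carrier}
    (hm : m ∈ I.toIdeal ^ t • (⊤ : Submodule R M.carrier)) : (quotPowπ I M t).lin m = 0 :=
  (Submodule.Quotient.mk_eq_zero _).2 hm

/-- The projection from `M / I ^ t M` to `M / J ^ t M` for `I ≤ J`. -/
def quotPowOfLE {I J : HomogeneousIdeal 𝒜} (h : I.toIdeal ≤ J.toIdeal) (t : ℕ) :
    quotPow I M t ⟶ quotPow J M t :=
  quotDesc _ _ (quotPowπ J M t) fun _ hm =>
    quotPowπ_apply_eq_zero M (Submodule.smul_mono_left (Ideal.pow_right_mono h t) hm)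

theorem quotPowπ_ofLE {I J : HomogeneousIdeal 𝒜} (h : I.toIdeal ≤ J.toIdeal) (t : ℕ) :
    quotPowπ I M t ≫ quotPowOfLE M h t = quotPowπ J M t :=
  quotπ_quotDesc _ _ _ _

/-- The projection from `M / (I ^ t + (x ^ t)) M` to `M / J ^ t M` if `J` contains `I` and `x`. -/
def smulQuotToQuotPow {I J : HomogeneousIdeal 𝒜} (h : I.toIdeal ≤ J.toIdeal)
    (hx : (x : R) ∈ J.toIdeal) (t : ℕ) : smulQuot (x ^ t) (quotPow I M t) ⟶ quotPow J M t :=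
  quotDesc _ _ (quotPowOfLE M h t) (by
    rintro _ ⟨l, rfl⟩
    obtain ⟨m, rfl⟩ := surjective_of_epi (quotPowπ I M t) l
    rw [LinearMap.mem_ker]
    change (quotPowOfLE M h t).lin (((x ^ t : 𝒜 0) : R) • (quotPowπ I M t).lin m) = 0
    rw [← map_smul, ← comp_lin_apply, quotPowπ_ofLE]
    refine quotPowπ_apply_eq_zero M (Submodule.smul_mem_smul ?_ Submodule.mem_top)
    rw [coe_pow_zero]
    exact Ideal.pow_mem_pow hx t)

theorem smulQuotπ_toQuotPow {I J : HomogeneousIdeal 𝒜} (h : I.toIdeal ≤ J.toIdeal)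
    (hx : (x : R) ∈ J.toIdeal) (t : ℕ) :
    quotPowπ I M t ≫ smulQuotπ _ _ ≫ smulQuotToQuotPow x M h hx t = quotPowπ J M t :=
  (congrArg (quotPowπ I M t ≫ ·) (quotπ_quotDesc _ _ _ _)).trans (quotPowπ_ofLE M h t)

/-- The projection from `M / J ^ (2 t) M` to `M / (I ^ t + (x ^ t)) M` if `J = I + (x)`. -/
def quotPowToSmulQuot {I J : HomogeneousIdeal 𝒜} (h : J.toIdeal = Ideal.span {(x : R)} ⊔ I.toIdeal)
    (t : ℕ) : quotPow J M (t + t) ⟶ smulQuot (x ^ t) (quotPow I M t) :=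
  quotDesc _ _ (quotPowπ I M t ≫ smulQuotπ _ _) (by
    change J.toIdeal ^ (t + t) • (⊤ : Submodule R M.carrier) ≤ _
    rw [h]
    refine (Submodule.smul_mono_left Ideal.sup_pow_add_le_pow_sup_pow).trans ?_
    rw [Submodule.sup_smul, sup_le_iff, Ideal.span_singleton_pow, Submodule.smul_le]
    constructor
    · intro r hr m _
      obtain ⟨c, rfl⟩ := Ideal.mem_span_singleton.1 hr
      rw [LinearMap.mem_ker, comp_lin_apply, mul_smul, map_smul, ← coe_pow_zero, smulQuotπ_smul]
    · intro m hm
      rw [LinearMap.mem_ker, comp_lin_apply, quotPowπ_apply_eq_zero M hm, map_zero])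

theorem quotPowπ_toSmulQuot {I J : HomogeneousIdeal 𝒜}
    (h : J.toIdeal = Ideal.span {(x : R)} ⊔ I.toIdeal) (t : ℕ) :
    quotPowπ J M (t + t) ≫ quotPowToSmulQuot x M h t = quotPowπ I M t ≫ smulQuotπ _ _ :=
  quotπ_quotDesc _ _ _ _

end

/-- The towers `M / (I ^ t + (x ^ t)) M` and `M / J ^ t M` are cofinal in each other for
`J = I + (x)`, so they give the same direct limits of `Ext`-groups. -/
theorem quotTowerAcyclic_iff {I J : HomogeneousIdeal 𝒜} {x : 𝒜 0}
    (h : J.toIdeal = Ideal.span {(x : R)} ⊔ I.toIdeal) {M N : GrMod 𝒜} :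
    QuotTowerAcyclic I x M N ↔ ∀ (i : ℕ) (w : limExt J M N i), w = 0 := by
  have hI : I.toIdeal ≤ J.toIdeal := h ▸ le_sup_right
  have hx : (x : R) ∈ J.toIdeal := h ▸ Ideal.mem_sup_left (Ideal.mem_span_singleton_self _)
  constructor
  · intro hD i w
    obtain ⟨t, α, rfl⟩ := w.exists_of
    obtain ⟨s, hs, e⟩ := hD i t (pull (smulQuotToQuotPow x M hI hx t) α)
    rw [limExt.of_eq_zero_iff]
    refine ⟨s + s, hs.trans (Nat.le_add_left s s), ?_⟩
    have hcomp : quotPowMap J M (hs.trans (Nat.le_add_left s s)) =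
        quotPowToSmulQuot x M h s ≫ quotTransition I x M hs ≫ smulQuotToQuotPow x M hI hx t := by
      rw [← cancel_epi (quotPowπ J M (s + s)), quotPowπ_comp, ← Category.assoc,
        quotPowπ_toSmulQuot, Category.assoc, ← Category.assoc (smulQuotπ _ _), quotπ_transition,
        Category.assoc, ← Category.assoc, quotPowπ_comp, smulQuotπ_toQuotPow]
    rw [hcomp, ← pull_pull, ← pull_pull, e, map_zero]
  · intro hJ i t α
    obtain ⟨s, hs, e⟩ := (limExt.of_eq_zero_iff (pull (quotPowToSmulQuot x M h t) α)).1 (hJ i _)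
    have hts : t ≤ s := (Nat.le_add_left t t).trans hs
    refine ⟨s, hts, ?_⟩
    have hcomp : quotTransition I x M hts =
        smulQuotToQuotPow x M hI hx s ≫ quotPowMap J M hs ≫ quotPowToSmulQuot x M h t := by
      rw [← cancel_epi (smulQuotπ _ _), ← cancel_epi (quotPowπ I M s), quotπ_transition,
        ← Category.assoc, quotPowπ_comp, ← Category.assoc (smulQuotπ _ _), ← Category.assoc,
        smulQuotπ_toQuotPow, ← Category.assoc, quotPowπ_comp, quotPowπ_toSmulQuot]
    rw [hcomp, ← pull_pull, ← pull_pull, e, map_zero]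

/-! ### Comparison of the two ideals in a fixed degree -/

/-- Nakayama's lemma: a Noetherian module over a local ring is zero if an element of the maximal
ideal acts on it surjectively. -/
theorem eq_zero_of_smul_surjective {A H : Type*} [CommRing A] [IsLocalRing A] [AddCommGroup H]
    [Module A H] [IsNoetherian A H] {x : A} (hx : x ∈ IsLocalRing.maximalIdeal A)
    (h : ∀ w : H, ∃ z, x • z = w) (w : H) : w = 0 := by
  have hle : (⊤ : Submodule A H) ≤ IsLocalRing.maximalIdeal A • ⊤ := by
    intro w _
    obtain ⟨z, rfl⟩ := h w
    exact Submodule.smul_mem_smul hx Submodule.mem_top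
  have htop : (⊤ : Submodule A H) = ⊥ :=
    Submodule.eq_bot_of_le_smul_of_le_jacobson_bot _ _ (IsNoetherian.noetherian _) hle
      (IsLocalRing.maximalIdeal_le_jacobson _)
  have hw : w ∈ (⊤ : Submodule A H) := Submodule.mem_top
  rwa [htop, Submodule.mem_bot] at hw

/-- In each degree, all generalized local cohomology with respect to `x R₀ + R₊` vanishes if and
only if all generalized local cohomology with respect to `R₊` does. -/
theorem forall_limExt_eq_zero_iff [IsNoetherianRing R] [IsLocalRing (𝒜 0)] {x : 𝒜 0}
    (hx : x ∈ IsLocalRing.maximalIdeal (𝒜 0)) (M N : GrMod 𝒜) [Module.Finite R M.carrier]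
    [Module.Finite R N.carrier] (n : ℤ) :
    (∀ (i : ℕ) (w : limExt (addIrrelevant 𝒜 (Ideal.span {x})) M (N.shift n) i), w = 0) ↔
      ∀ (i : ℕ) (w : limExt (HomogeneousIdeal.irrelevant 𝒜) M (N.shift n) i), w = 0 := by
  rw [← quotTowerAcyclic_iff (addIrrelevant_span_toIdeal x)]
  refine ⟨fun h i => ?_, quotTowerAcyclic_of_limExt⟩
  have := (finiteComponents M i N).1 n
  exact eq_zero_of_smul_surjective hx (h.smul_surjective i)

theorem aStar_eq_of_forall_iff [IsNoetherianRing R] {I J : HomogeneousIdeal 𝒜} {M N : GrMod 𝒜}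
    [Module.Finite R M.carrier]
    (h : ∀ n : ℤ, (∀ (i : ℕ) (w : limExt I M (N.shift n) i), w = 0) ↔
      ∀ (i : ℕ) (w : limExt J M (N.shift n) i), w = 0) : aStar I M N = aStar J M N := by
  have h' : ∀ n : ℤ, (∃ i, genLocalCohomologyDegree I M N i n ≠ ⊥) ↔
      ∃ i, genLocalCohomologyDegree J M N i n ≠ ⊥ := by
    intro n
    rw [← not_iff_not]
    push Not
    simp only [genLocalCohomologyDegree_eq_bot_iff]
    exact h n
  have key : ∀ I : HomogeneousIdeal 𝒜, aStar I M N =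
      sSup {e : EReal | ∃ n : ℤ, (∃ i, genLocalCohomologyDegree I M N i n ≠ ⊥) ∧
        e = ((n : ℝ) : EReal)} := by
    intro I
    refine le_antisymm (iSup_le fun i => sSup_le_sSup ?_) (sSup_le ?_)
    · rintro e ⟨n, hn, rfl⟩
      exact ⟨n, ⟨i, hn⟩, rfl⟩
    · rintro e ⟨n, ⟨i, hn⟩, rfl⟩
      exact le_iSup_of_le i (le_sSup ⟨n, hn, rfl⟩)
  rw [key, key]
  simp only [h']

end

end GrMod

end

/-- Let `R = ⨁ 𝒜 n` be a standard graded Noetherian ring with `R₀ = 𝒜 0` local, let `x` lie in the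
maximal ideal of `R₀`, and let `M`, `N` be finitely generated `ℤ`-graded `R`-modules. Then
`a^*_{x R₀ + R₊}(M, N) = a^*_{R₊}(M, N)`. -/
theorem mainTheorem11 {R : Type u} [CommRing R] [IsNoetherianRing R]
    (𝒜 : ℕ → AddSubgroup R) [GradedRing 𝒜]
    (hstd : Algebra.adjoin (𝒜 0) (𝒜 1 : Set R) = ⊤)
    [IsLocalRing (𝒜 0)]
    (x : 𝒜 0) (hx : x ∈ IsLocalRing.maximalIdeal (𝒜 0))
    (M N : GrMod 𝒜) [Module.Finite R M.carrier] [Module.Finite R N.carrier] :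
    GrMod.aStar (GrMod.addIrrelevant 𝒜 (Ideal.span {x})) M N =
      GrMod.aStar (HomogeneousIdeal.irrelevant 𝒜) M N :=
  GrMod.aStar_eq_of_forall_iff (GrMod.forall_limExt_eq_zero_iff hx M N)
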